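/- Theorem (Kraśkiewicz–Pragacz). Let $\Bbbk$ be any field, let $n\ge 0$ and let $w\in S_n$. Then the character of the flagged Schur module $E_\bullet^{D(w)}$ of the standard flag, with respect to the torus $T$ of diagonal matrices, is the Schubert polynomial of $w$: $$\operatorname{char}_T\big(E_\bullet^{D(w)}\big)=\mathfrak S_w\quad\text{in }\mathbb Z[x_1,\dots,x_n].$$ Here the notation is as follows. * Rothe diagram: $D(w)=[\mathbf a^{(1)},\dots,\mathbf a^{(n)}]$ is the tuple of subsets $\mathbf a^{(j)}=\{\,i : j<w(i)\text{ and } i<w^{-1}(j)\,\}$ of $\{1,\dots,n\}$; its boxes are the pairs $(i,j)$ with $i\in\mathbf a^{(j)}$. * Flagged Schur module: let $D=[\mathbf a^{(1)},\dots,\mathbf a^{(m)}]$ be a tuple of subsets of $\{1,\dots,n\}$, and let $Z_\bullet=(z_{ij})$ be the generic lower-triangular $n\times n$ matrix, with independent variables $z_{ij}$ for $j\le i$ and $z_{ij}=0$ for $j>i$ (for each $i$, the variables $z_{i1},\dots,z_{ii}$ form the basis of the $i$-th piece $E_i$ of the standard flag $E_n\twoheadrightarrow\cdots\twoheadrightarrow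 E_1$). A column-strict flagged filling $\tau$ of $D$ assigns to each box $(i,j)$ an entry $\tau(i,j)\in\{1,\dots,i\}$ such that the entries strictly increase down each column. Put $\Delta_\tau=\prod_{j=1}^m\Delta_{\mathbf a^{(j)},\mathbf b^{(j)}}(Z_\bullet)$, where $\mathbf b^{(j)}$ is the set of entries of $\tau$ in column $j$ and $\Delta_{\mathbf a,\mathbf b}$ is the minor on rows $\mathbf a$ and columns $\mathbf b$. Let $TE_\bullet^D$ be the free $\Bbbk$-module with one basis element $z_\tau$ for each column-strict flagged filling $\tau$ of $D$. Then $E_\bullet^D$ is the quotient of $TE_\bullet^D$ by the kernel of $z_\tau\mapsto\Delta_\tau$; equivalently, it is the span of all the $\Delta_\tau$ in $\Bbbk[Z_\bullet]$. * Character: $\operatorname{diag}(x_1,\dots,x_n)$ acts by $z_{ij}\mapsto x_jz_{ij}$, and $\operatorname{char}_T(E_\bullet^D)=\sum_\alpha \dim_\Bbbk (E_\bullet^D)_\alpha\,x^\alpha$, where $(E_\bullet^D)_\alpha$ is the subspace on which $\operatorname{diag}(x_1,\dots,x_n)$, with indeterminate entries, acts as multiplication by $x^\alpha$. * Schubert polynomials: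 $\mathfrak S_{[n,n-1,\dots,1]}=x_1^{n-1}x_2^{n-2}\cdots x_{n-1}$, and $\mathfrak S_{ws_k}=\partial_k\mathfrak S_w$ whenever $w(k)>w(k+1)$, where $s_k$ is the transposition of $k$ and $k+1$ and $\partial_kf=(f-s_kf)/(x_k-x_{k+1})$. -/

import Mathlib

open MvPolynomial

/-! ### Diagrams and flagged Schur modules -/

/-- A diagram with `m` columns and boxes in rows `0, …, n - 1` (rows and columns are numbered from
zero): a tuple of sets of rows, the boxes of column `j` being in the rows `i ∈ D j`. -/
abbrev Diagram (n m : ℕ) : Type := Fin m → Finset (Fin n)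

namespace Diagram

variable {n m : ℕ}

/-- A filling of `D` puts an entry `τ j i` into the box in row `i` of column `j`. -/
abbrev Filling (D : Diagram n m) : Type := (j : Fin m) → D j → Fin n

/-- Entries increase strictly down every column. -/
def Filling.IsColumnStrict {D : Diagram n m} (τ : D.Filling) : Prop :=
  ∀ j, StrictMono (τ j)

/-- The entry of a box in row `i` is at most `i`. -/
def Filling.IsFlagged {D : Diagram n m} (τ : D.Filling) : Prop :=
  ∀ j, ∀ i : D j, τ j i ≤ (i : Fin n)

end Diagram

/-- Indices of the variables `z_{ij}` with `j ≤ i`; the variables `z_{ij}`, `j ≤ i`, form the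
standard basis of the `i`-th piece `E_i` of the standard quotient flag. -/
abbrev FlagIdx (n : ℕ) : Type := {p : Fin n × Fin n // p.2 ≤ p.1}

/-- The ring `Sym(E_1) ⊗ ⋯ ⊗ Sym(E_n)` of the standard flag, i.e. the polynomial ring in the
entries of the generic lower-triangular matrix. -/
abbrev FlagRing (n : ℕ) (k : Type*) [CommRing k] : Type _ := MvPolynomial (FlagIdx n) k

/-- The generic lower-triangular matrix. -/
noncomputable def flagMatrix (n : ℕ) (k : Type*) [CommRing k] :
    Matrix (Fin n) (Fin n) (FlagRing n k) :=
  Matrix.of fun i j => if h : j ≤ i then X ⟨(i, j), h⟩ else 0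

/-- The product over all columns of the minors of the generic lower-triangular matrix: for column
`j`, the rows of the minor are the rows in `D j` and its columns are the entries of `τ` in
column `j`. -/
noncomputable def minorProduct (k : Type*) [CommRing k] {n m : ℕ} {D : Diagram n m}
    (τ : D.Filling) : FlagRing n k :=
  ∏ j, ((flagMatrix n k).submatrix (fun p : D j => (p : Fin n)) (τ j)).det

/-- The flagged tensor product module of the diagram, free on the column-strict flagged
fillings. -/
abbrev flaggedTensorModule (k : Type*) [CommRing k] {n m : ℕ} (D : Diagram n m) : Type _ :=
  {τ : D.Filling // τ.IsColumnStrict ∧ τ.IsFlagged} →₀ k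

/-- The map from the flagged tensor product module to the polynomial ring which sends the basis
element of a filling to its product of minors. Its kernel consists of the exchange relations. -/
noncomputable def exchangeMap (k : Type*) [CommRing k] {n m : ℕ} (D : Diagram n m) :
    flaggedTensorModule k D →ₗ[k] FlagRing n k :=
  Finsupp.linearCombination k fun τ => minorProduct k τ.1

/-- The flagged Schur module of a diagram for the standard flag: the quotient of the flagged
tensor product module by the exchange relations, realised as the image of `exchangeMap`, i.e. as
the span of the products of minors of column-strict flagged fillings. -/
noncomputable def flaggedSchurModule (k : Type*) [CommRing k] {n m : ℕ} (D : Diagram n m) :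
    Submodule k (FlagRing n k) :=
  LinearMap.range (exchangeMap k D)

/-! ### Characters -/

/-- The action of the generic point `diag(x_1, …, x_n)` of the torus of diagonal matrices, that is
the coaction of its coordinate ring: `z_{ij} ↦ x_j z_{ij}`. (The generic point is used, and not
only the points over `k`, so that weights are also separated over finite fields.) -/
noncomputable def torusAction (n : ℕ) (k : Type*) [CommRing k] :
    FlagRing n k →ₐ[k] MvPolynomial (FlagIdx n) (MvPolynomial (Fin n) k) :=
  aeval fun p => C (X p.1.2) * X p

/-- The weight space of weight `x^α` in the flagged Schur module: those elements on which
`diag(x_1, …, x_n)` acts as multiplication by `x^α`. -/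
noncomputable def flaggedWeightSpace (k : Type*) [CommRing k] {n m : ℕ} (D : Diagram n m)
    (α : Fin n →₀ ℕ) : Submodule k (FlagRing n k) where
  carrier := {f | f ∈ flaggedSchurModule k D ∧
    torusAction n k f = C (monomial α 1) * MvPolynomial.map C f}
  add_mem' := by
    rintro f g ⟨hf, hf'⟩ ⟨hg, hg'⟩
    exact ⟨add_mem hf hg, by rw [map_add, map_add, hf', hg', mul_add]⟩
  zero_mem' := ⟨zero_mem _, by simp⟩
  smul_mem' := by
    rintro c f ⟨hf, hf'⟩
    refine ⟨Submodule.smul_mem _ c hf, ?_⟩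
    have hc : MvPolynomial.map C (c • f) =
        c • (MvPolynomial.map C f : MvPolynomial (FlagIdx n) (MvPolynomial (Fin n) k)) := by
      rw [smul_eq_C_mul, map_mul, map_C, ← smul_eq_C_mul, ← MvPolynomial.algebraMap_eq,
        algebraMap_smul]
    rw [map_smul, hf', hc, mul_smul_comm]

/-- The character of the flagged Schur module under the torus of diagonal matrices: the sum of
`dim (weight space of weight x^α) • x^α` over all weights. -/
noncomputable def flaggedCharacter (k : Type*) [Field k] {n m : ℕ} (D : Diagram n m) :
    MvPolynomial (Fin n) ℤ :=
  ∑ᶠ α : Fin n →₀ ℕ, monomial α (Module.finrank k (flaggedWeightSpace k D α) : ℤ)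

/-! ### Rothe diagrams -/

/-- The Rothe diagram of `w`: the boxes `(i, j)` with `j < w i` and `i < w⁻¹ j`. -/
def rotheDiagram {n : ℕ} (w : Equiv.Perm (Fin n)) : Diagram n n :=
  fun j => Finset.univ.filter fun i => j < w i ∧ i < w⁻¹ j

/-! ### Schubert polynomials -/

theorem X_sub_X_dvd_sub_rename_swap {σ : Type*} [DecidableEq σ] (a b : σ)
    (f : MvPolynomial σ ℤ) :
    (X a - X b : MvPolynomial σ ℤ) ∣ f - rename (Equiv.swap a b) f := by
  induction f using MvPolynomial.induction_on with
  | C c => simp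
  | add p q hp hq =>
    rw [map_add, add_sub_add_comm]
    exact dvd_add hp hq
  | mul_X p c hp =>
    have hc : (X a - X b : MvPolynomial σ ℤ) ∣ X c - X (Equiv.swap a b c) := by
      rcases eq_or_ne c a with rfl | ha
      · simp
      · rcases eq_or_ne c b with rfl | hb
        · rw [Equiv.swap_apply_right]
          exact ⟨-1, by ring⟩
        · rw [Equiv.swap_apply_of_ne_of_ne ha hb]
          simp
    have key : p * X c - rename (Equiv.swap a b) (p * X c) =
        (p - rename (Equiv.swap a b) p) * X c +
          rename (Equiv.swap a b) p * (X c - X (Equiv.swap a b c)) := by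
      rw [map_mul, rename_X]
      ring
    rw [key]
    exact dvd_add (hp.mul_right _) (hc.mul_left _)

/-- The divided difference `(f - s f) / (x_a - x_b)`, where `s` exchanges `x_a` and `x_b`. -/
noncomputable def dividedDifference {σ : Type*} [DecidableEq σ] (a b : σ)
    (f : MvPolynomial σ ℤ) : MvPolynomial σ ℤ :=
  (X_sub_X_dvd_sub_rename_swap a b f).choose

theorem X_sub_X_mul_dividedDifference {σ : Type*} [DecidableEq σ] (a b : σ)
    (f : MvPolynomial σ ℤ) :
    (X a - X b) * dividedDifference a b f = f - rename (Equiv.swap a b) f :=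
  (X_sub_X_dvd_sub_rename_swap a b f).choose_spec.symm

/-- `w` has an ascent at the positions `r, r + 1`. -/
def IsAscent {n : ℕ} (w : Equiv.Perm (Fin n)) (r : ℕ) : Prop :=
  ∃ h : r + 1 < n, w ⟨r, Nat.lt_of_succ_lt h⟩ < w ⟨r + 1, h⟩

/-- The pairs of positions whose values are in increasing order. -/
def nonInversions {n : ℕ} (w : Equiv.Perm (Fin n)) : Finset (Fin n × Fin n) :=
  Finset.univ.filter fun p => p.1 < p.2 ∧ w p.1 < w p.2

theorem card_nonInversions_mul_swap_lt {n : ℕ} (w : Equiv.Perm (Fin n)) {r : ℕ}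
    (h : r + 1 < n) (hw : w ⟨r, Nat.lt_of_succ_lt h⟩ < w ⟨r + 1, h⟩) :
    (nonInversions (w * Equiv.swap ⟨r, Nat.lt_of_succ_lt h⟩ ⟨r + 1, h⟩)).card <
      (nonInversions w).card := by
  set a : Fin n := ⟨r, Nat.lt_of_succ_lt h⟩ with ha
  set b : Fin n := ⟨r + 1, h⟩ with hb
  have hab : (a, b) ∈ nonInversions w := by
    refine Finset.mem_filter.mpr ⟨Finset.mem_univ _, ?_, hw⟩
    exact Nat.lt_succ_self r
  rw [← Finset.card_map ((Equiv.prodCongr (Equiv.swap a b) (Equiv.swap a b)).toEmbedding)]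
  refine Finset.card_lt_card ⟨?_, fun hs => ?_⟩
  · intro p hp
    obtain ⟨⟨x, y⟩, hq, rfl⟩ := Finset.mem_map.mp hp
    replace hq := (Finset.mem_filter.mp hq).2
    simp only [Equiv.Perm.mul_apply] at hq
    simp only [nonInversions, Finset.mem_filter, Finset.mem_univ, true_and,
      Equiv.coe_toEmbedding, Equiv.prodCongr_apply, Prod.map_apply]
    refine ⟨?_, hq.2⟩
    rcases hq with ⟨hxy, hwxy⟩
    have hne : ¬ (x = a ∧ y = b) := by
      rintro ⟨rfl, rfl⟩
      rw [Equiv.swap_apply_left, Equiv.swap_apply_right] at hwxy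
      exact absurd hw (not_lt.mpr hwxy.le)
    simp only [Equiv.swap_apply_def]
    split_ifs <;> simp only [Fin.lt_def, Fin.ext_iff, ha, hb] at * <;> omega
  · obtain ⟨⟨x, y⟩, hq, hqe⟩ := Finset.mem_map.mp (hs hab)
    replace hq := (Finset.mem_filter.mp hq).2
    simp only [Equiv.coe_toEmbedding, Equiv.prodCongr_apply, Prod.map_apply,
      Prod.mk.injEq] at hqe
    have hx : x = b := by
      have := congrArg (Equiv.swap a b) hqe.1
      rwa [← Equiv.Perm.mul_apply, Equiv.swap_mul_self, Equiv.Perm.one_apply,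
        Equiv.swap_apply_left] at this
    have hy : y = a := by
      have := congrArg (Equiv.swap a b) hqe.2
      rwa [← Equiv.Perm.mul_apply, Equiv.swap_mul_self, Equiv.Perm.one_apply,
        Equiv.swap_apply_right] at this
    have := hq.1
    rw [hx, hy, Fin.lt_def] at this
    simp only [ha, hb] at this
    omega

open Classical in
/-- The Schubert polynomial of `w`, by descending induction on the length: it is
`x_1^{n-1} x_2^{n-2} ⋯ x_{n-1}` if `w` has no ascent, i.e. `w = [n, n-1, …, 1]`; otherwise it is
`∂_r 𝔖_{w s_r}` for the first ascent `r` of `w`. -/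
noncomputable def schubertPolynomial {n : ℕ} (w : Equiv.Perm (Fin n)) :
    MvPolynomial (Fin n) ℤ :=
  if hw : ∃ r, IsAscent w r then
    have h : Nat.find hw + 1 < n := (Nat.find_spec hw).1
    dividedDifference ⟨Nat.find hw, Nat.lt_of_succ_lt h⟩ ⟨Nat.find hw + 1, h⟩
      (schubertPolynomial
        (w * Equiv.swap ⟨Nat.find hw, Nat.lt_of_succ_lt h⟩ ⟨Nat.find hw + 1, h⟩))
  else ∏ i : Fin n, X i ^ (n - 1 - (i : ℕ))
termination_by (nonInversions w).card
decreasing_by exact card_nonInversions_mul_swap_lt w _ (Nat.find_spec hw).2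

/-! ### Divided differences -/

section DividedDifference

variable {σ : Type*}

/-! Schubert polynomials satisfy the transition recursion as an equality, the characters satisfy it
as an inequality, and one upper bound closes the gap.

Let u increase after position r, and let s be the first later position with an entry larger than
u(r). Monk's formula (`monk`) gives S_{u(r s)} = x_r S_u + sum_i S_{u(i r)}, over the i < r for
which (i r) creates exactly one inversion (`IsTransition.schubertPolynomial_eq`). Every permutation
arises from the identity by such steps (`transition_induction`).

The module of u(r s) contains z_rr times the module of u. By a Laplace expansion
(`mul_mem_of_mem_union_inter`) it also contains, for each i, the span B_i obtained by replacing the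
columns u(r) and u(i) by their intersection and union. Adding t times row i to row r and extracting
a fixed power of t kills z_rr times the module of u and all B_j with j > i, while the image of B_i
contains the module of u(i r). This triangularity gives `IsTransition.sum_finrank_le`, hence S_w <=
char coefficientwise (`coeff_schubertPolynomial_le`).

Consequently equality for u(r s) forces equality for every u(i r)
(`IsTransition.flaggedCharacter_eq`), and an upper bound is needed in one case only. After two fixed
points n, n+1 (counting from zero) are appended to u, passing to u(n n+1) adds one box in an empty
column. The character is then at most (x_0 + ... + x_n) times that of u, while Monk's formula makes
this factor exact for Schubert polynomials. Equality descends from u(n n+1) through the u(R R+1) to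
u(s s+1), and from there to u(r s). Stability of both sides removes the fixed points. -/

theorem X_sub_X_ne_zero {a b : σ} (h : a ≠ b) : (X a - X b : MvPolynomial σ ℤ) ≠ 0 :=
  sub_ne_zero.mpr fun e => h (X_injective e)

variable [DecidableEq σ]

theorem dividedDifference_eq_of_mul_eq {a b : σ} (h : a ≠ b) {f g : MvPolynomial σ ℤ}
    (hg : (X a - X b) * g = f - rename (Equiv.swap a b) f) : dividedDifference a b f = g :=
  mul_left_cancel₀ (X_sub_X_ne_zero h) ((X_sub_X_mul_dividedDifference a b f).trans hg.symm)

theorem rename_swap_rename_swap (a b : σ) (f : MvPolynomial σ ℤ) :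
    rename (Equiv.swap a b) (rename (Equiv.swap a b) f) = f := by
  rw [rename_rename, ← Equiv.coe_trans, ← Equiv.Perm.mul_def, Equiv.swap_mul_self]
  exact rename_id_apply f

theorem rename_swap_dividedDifference {a b : σ} (h : a ≠ b) (f : MvPolynomial σ ℤ) :
    rename (Equiv.swap a b) (dividedDifference a b f) = dividedDifference a b f := by
  refine (dividedDifference_eq_of_mul_eq h ?_).symm
  have e := congrArg (rename (Equiv.swap a b)) (X_sub_X_mul_dividedDifference a b f)
  simp only [map_mul, map_sub, rename_X, Equiv.swap_apply_left, Equiv.swap_apply_right,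
    rename_swap_rename_swap] at e
  linear_combination -e

theorem dividedDifference_eq_zero {a b : σ} (h : a ≠ b) {f : MvPolynomial σ ℤ}
    (hf : rename (Equiv.swap a b) f = f) : dividedDifference a b f = 0 :=
  dividedDifference_eq_of_mul_eq h (by rw [hf, sub_self, mul_zero])

theorem dividedDifference_dividedDifference {a b : σ} (h : a ≠ b) (f : MvPolynomial σ ℤ) :
    dividedDifference a b (dividedDifference a b f) = 0 :=
  dividedDifference_eq_zero h (rename_swap_dividedDifference h f)

theorem dividedDifference_add {a b : σ} (h : a ≠ b) (f g : MvPolynomial σ ℤ) :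
    dividedDifference a b (f + g) = dividedDifference a b f + dividedDifference a b g := by
  refine dividedDifference_eq_of_mul_eq h ?_
  rw [mul_add, X_sub_X_mul_dividedDifference, X_sub_X_mul_dividedDifference, map_add]
  ring

/-- The divided difference as an additive map. -/
noncomputable def dividedDifferenceHom {a b : σ} (h : a ≠ b) :
    MvPolynomial σ ℤ →+ MvPolynomial σ ℤ :=
  AddMonoidHom.mk' (dividedDifference a b) (dividedDifference_add h)

/-- The twisted Leibniz rule. -/
theorem dividedDifference_mul {a b : σ} (h : a ≠ b) (f g : MvPolynomial σ ℤ) :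
    dividedDifference a b (f * g) =
      dividedDifference a b f * g + rename (Equiv.swap a b) f * dividedDifference a b g := by
  refine dividedDifference_eq_of_mul_eq h ?_
  rw [map_mul]
  linear_combination g * X_sub_X_mul_dividedDifference a b f +
    rename (Equiv.swap a b) f * X_sub_X_mul_dividedDifference a b g

theorem dividedDifference_X_left {a b : σ} (h : a ≠ b) :
    dividedDifference a b (X a) = 1 :=
  dividedDifference_eq_of_mul_eq h (by simp)

theorem dividedDifference_X_right {a b : σ} (h : a ≠ b) :
    dividedDifference a b (X b) = -1 :=
  dividedDifference_eq_of_mul_eq h (by simp)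

theorem dividedDifference_X_of_ne {a b c : σ} (h : a ≠ b) (ha : c ≠ a) (hb : c ≠ b) :
    dividedDifference a b (X c) = 0 :=
  dividedDifference_eq_zero h (by rw [rename_X, Equiv.swap_apply_of_ne_of_ne ha hb])

theorem rename_dividedDifference {τ : Type*} [DecidableEq τ] {φ : σ → τ}
    (hφ : Function.Injective φ) {a b : σ} (h : a ≠ b) (f : MvPolynomial σ ℤ) :
    rename φ (dividedDifference a b f) = dividedDifference (φ a) (φ b) (rename φ f) := by
  refine (dividedDifference_eq_of_mul_eq (hφ.ne h) ?_).symm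
  have e := congrArg (rename φ) (X_sub_X_mul_dividedDifference a b f)
  simp only [map_mul, map_sub, rename_X, rename_rename] at e
  rw [e, rename_rename]
  congr 3
  funext x
  exact hφ.map_swap a b x

theorem dividedDifference_comm {a b c d : σ} (hab : a ≠ b) (hcd : c ≠ d) (hac : a ≠ c)
    (had : a ≠ d) (hbc : b ≠ c) (hbd : b ≠ d) (f : MvPolynomial σ ℤ) :
    dividedDifference a b (dividedDifference c d f) =
      dividedDifference c d (dividedDifference a b f) := by
  refine dividedDifference_eq_of_mul_eq hab (mul_left_cancel₀ (X_sub_X_ne_zero hcd) ?_)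
  have h1 := X_sub_X_mul_dividedDifference c d (dividedDifference a b f)
  have h2 := X_sub_X_mul_dividedDifference a b f
  have h3 := X_sub_X_mul_dividedDifference c d f
  have h4 := congrArg (rename (Equiv.swap c d)) h2
  have h5 := congrArg (rename (Equiv.swap a b)) h3
  simp only [map_mul, map_sub, rename_X, Equiv.swap_apply_of_ne_of_ne hac had,
    Equiv.swap_apply_of_ne_of_ne hbc hbd, Equiv.swap_apply_of_ne_of_ne hac.symm hbc.symm,
    Equiv.swap_apply_of_ne_of_ne had.symm hbd.symm] at h4 h5
  have h6 : rename (Equiv.swap a b) (rename (Equiv.swap c d) f) =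
      rename (Equiv.swap c d) (rename (Equiv.swap a b) f) := by
    rw [rename_rename, rename_rename]
    congr 2
    funext x
    have : Equiv.swap a b * Equiv.swap c d = Equiv.swap c d * Equiv.swap a b :=
      (Equiv.Perm.disjoint_swap_swap (by simp [*])).commute
    exact DFunLike.congr_fun this x
  linear_combination (X a - X b) * h1 + h2 - h4 - h3 + h5 - h6

theorem dividedDifference_braid {a b c : σ} (hab : a ≠ b) (hbc : b ≠ c) (hac : a ≠ c)
    (f : MvPolynomial σ ℤ) :
    dividedDifference a b (dividedDifference b c (dividedDifference a b f)) =
      dividedDifference b c (dividedDifference a b (dividedDifference b c f)) := by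
  -- Each threefold composite is the alternating sum over the six permutations of the variables,
  -- divided by the Vandermonde product; `key` is used for (a, b, c) and for (c, b, a).
  have key : ∀ x y z : σ, x ≠ y → y ≠ z → x ≠ z →
      (X x - X y) * (X y - X z) * (X x - X z) *
        dividedDifference x y (dividedDifference y z (dividedDifference x y f)) =
      f - rename (Equiv.swap x y) f - rename (Equiv.swap y z) f +
        rename (Equiv.swap y z) (rename (Equiv.swap x y) f) +
        rename (Equiv.swap x y) (rename (Equiv.swap y z) f) -
        rename (Equiv.swap x y) (rename (Equiv.swap y z) (rename (Equiv.swap x y) f)) := by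
    intro x y z hxy hyz hxz
    have h1 := X_sub_X_mul_dividedDifference x y f
    have h2 := X_sub_X_mul_dividedDifference y z (dividedDifference x y f)
    have h3 := X_sub_X_mul_dividedDifference x y
      (dividedDifference y z (dividedDifference x y f))
    have h4 := congrArg (rename (Equiv.swap x y)) h2
    have h5 := congrArg (rename (Equiv.swap y z)) h1
    have h6 := congrArg (rename (Equiv.swap x y)) h5
    simp only [map_mul, map_sub, rename_X, Equiv.swap_apply_left, Equiv.swap_apply_right,
      Equiv.swap_apply_of_ne_of_ne hxy hxz, Equiv.swap_apply_of_ne_of_ne hxz.symm hyz.symm,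
      rename_swap_dividedDifference hxy] at h4 h5 h6
    linear_combination (X y - X z) * (X x - X z) * h3 + (X x - X z) * h2 - (X y - X z) * h4
      + h1 - h5 + h6
  refine mul_left_cancel₀ (mul_ne_zero (mul_ne_zero (X_sub_X_ne_zero hab)
    (X_sub_X_ne_zero hbc)) (X_sub_X_ne_zero hac)) ?_
  have h1 := key a b c hab hbc hac
  have h2 := key c b a hbc.symm hab.symm hac.symm
  have hs : ∀ x y : σ, x ≠ y → ∀ g : MvPolynomial σ ℤ,
      dividedDifference y x g = -dividedDifference x y g := fun x y h g =>
    dividedDifference_eq_of_mul_eq h.symm (by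
      rw [Equiv.swap_comm y x]
      linear_combination X_sub_X_mul_dividedDifference x y g)
  have hneg : ∀ x y : σ, x ≠ y → ∀ g : MvPolynomial σ ℤ,
      dividedDifference x y (-g) = -dividedDifference x y g := fun x y h g =>
    map_neg (dividedDifferenceHom h) g
  simp only [hs b c hbc, hs a b hab, hneg _ _ hab, neg_neg,
    Equiv.swap_comm c b, Equiv.swap_comm b a] at h2
  have hr : rename (Equiv.swap a b) (rename (Equiv.swap b c) (rename (Equiv.swap a b) f)) =
      rename (Equiv.swap b c) (rename (Equiv.swap a b) (rename (Equiv.swap b c) f)) := by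
    simp only [rename_rename]
    congr 2
    have h : Equiv.swap a b * Equiv.swap b c * Equiv.swap a b =
        Equiv.swap b c * Equiv.swap a b * Equiv.swap b c := by
      rw [Equiv.swap_mul_swap_mul_swap hab hac, Equiv.swap_comm a b, Equiv.swap_comm b c,
        Equiv.swap_mul_swap_mul_swap hbc.symm hac.symm, Equiv.swap_comm]
    exact congrArg DFunLike.coe h
  linear_combination h1 - h2 - hr

end DividedDifference

/-! ### Schubert polynomials -/

section Schubert

variable {n : ℕ}

theorem nonInversions_mul_swap_card_lt (w : Equiv.Perm (Fin n)) {a b : Fin n}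
    (hab : (a : ℕ) + 1 = b) (h : w a < w b) :
    (nonInversions (w * Equiv.swap a b)).card < (nonInversions w).card := by
  obtain ⟨a, ha⟩ := a
  obtain ⟨b, hb⟩ := b
  obtain rfl : a + 1 = b := hab
  exact card_nonInversions_mul_swap_lt w hb h

theorem schubertPolynomial_of_no_ascent (w : Equiv.Perm (Fin n))
    (h : ∀ a b : Fin n, (a : ℕ) + 1 = b → w b < w a) :
    schubertPolynomial w = ∏ i : Fin n, X i ^ (n - 1 - (i : ℕ)) := by
  rw [schubertPolynomial, dif_neg]
  rintro ⟨r, hr, hw⟩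
  exact absurd (h _ _ rfl) hw.asymm

theorem exists_first_ascent (w : Equiv.Perm (Fin n)) {a b : Fin n}
    (hab : (a : ℕ) + 1 = b) (h : w a < w b) :
    ∃ c d : Fin n, (c : ℕ) + 1 = d ∧ w c < w d ∧ c ≤ a ∧
      schubertPolynomial w = dividedDifference c d (schubertPolynomial (w * Equiv.swap c d)) := by
  classical
  have hw : ∃ r, IsAscent w r := by
    refine ⟨a, hab ▸ b.2, ?_⟩
    convert h using 2
    exact Fin.ext hab
  refine ⟨⟨Nat.find hw, Nat.lt_of_succ_lt (Nat.find_spec hw).1⟩,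
    ⟨Nat.find hw + 1, (Nat.find_spec hw).1⟩, rfl, (Nat.find_spec hw).2, ?_, ?_⟩
  · refine Fin.mk_le_of_le_val (Nat.find_min' hw ⟨hab ▸ b.2, ?_⟩)
    convert h using 2
    exact Fin.ext hab
  · conv_lhs => rw [schubertPolynomial, dif_pos hw]

/-- The defining recursion holds at every ascent. -/
theorem schubertPolynomial_of_ascent (w : Equiv.Perm (Fin n)) {a b : Fin n}
    (hab : (a : ℕ) + 1 = b) (h : w a < w b) :
    schubertPolynomial w = dividedDifference a b (schubertPolynomial (w * Equiv.swap a b)) := by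
  induction hN : (nonInversions w).card using Nat.strong_induction_on generalizing w a b with
  | _ N IH =>
  subst hN
  obtain ⟨c, d, hcd, hw, hca, he⟩ := exists_first_ascent w hab h
  have ne : a ≠ b := by rintro rfl; omega
  have ne' : c ≠ d := by rintro rfl; omega
  -- The definition uses the first ascent (c, d). If it overlaps (a, b), the two recursions meet
  -- after two further steps by the braid relation; if it is disjoint, after one further step by
  -- commutation.
  rcases eq_or_lt_of_le hca with rfl | hlt
  · obtain rfl : d = b := Fin.ext (by omega)
    exact he
  have l1 := nonInversions_mul_swap_card_lt w hcd hw
  have l2 := nonInversions_mul_swap_card_lt w hab h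
  rw [Fin.lt_def] at hlt
  have hcb : c ≠ b := by rintro rfl; omega
  have hcan : c ≠ a := by rintro rfl; omega
  by_cases hda : d = a
  · subst hda
    have e1 := IH _ l1 (w * Equiv.swap c d) hab
      (by simpa [Equiv.swap_apply_of_ne_of_ne hcb.symm ne.symm] using hw.trans h) rfl
    have e2 := IH _ l2 (w * Equiv.swap d b) hcd
      (by simpa [Equiv.swap_apply_of_ne_of_ne hcan hcb] using hw.trans h) rfl
    have l3 := nonInversions_mul_swap_card_lt (w * Equiv.swap c d) hab
      (by simpa [Equiv.swap_apply_of_ne_of_ne hcb.symm ne.symm] using hw.trans h)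
    have l4 := nonInversions_mul_swap_card_lt (w * Equiv.swap d b) hcd
      (by simpa [Equiv.swap_apply_of_ne_of_ne hcan hcb] using hw.trans h)
    have e3 := IH _ (l3.trans l1) (w * Equiv.swap c d * Equiv.swap d b) hcd
      (by simpa [Equiv.swap_apply_of_ne_of_ne hcb.symm ne.symm,
        Equiv.swap_apply_of_ne_of_ne hcan hcb] using h) rfl
    have e4 := IH _ (l4.trans l2) (w * Equiv.swap d b * Equiv.swap c d) hab
      (by simpa [Equiv.swap_apply_of_ne_of_ne hcb.symm ne.symm,
        Equiv.swap_apply_of_ne_of_ne hcan hcb] using hw) rfl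
    have e5 : w * Equiv.swap d b * Equiv.swap c d * Equiv.swap d b =
        w * Equiv.swap c d * Equiv.swap d b * Equiv.swap c d := by
      simp only [mul_assoc]
      rw [← mul_assoc (Equiv.swap d b), ← mul_assoc (Equiv.swap c d),
        Equiv.swap_mul_swap_mul_swap hcan hcb, Equiv.swap_comm c d, Equiv.swap_comm d b,
        Equiv.swap_mul_swap_mul_swap ne.symm hcb.symm, Equiv.swap_comm]
    rw [he, e1, e3, e2, e4, e5, dividedDifference_braid ne' ne hcb]
  · have hdb : d ≠ b := by rintro rfl; omega
    have e1 := IH _ l1 (w * Equiv.swap c d) hab (by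
      simpa [Equiv.swap_apply_of_ne_of_ne hcan.symm (Ne.symm hda),
        Equiv.swap_apply_of_ne_of_ne hcb.symm hdb.symm] using h) rfl
    have e2 := IH _ l2 (w * Equiv.swap a b) hcd (by
      simpa [Equiv.swap_apply_of_ne_of_ne hcan hcb,
        Equiv.swap_apply_of_ne_of_ne hda hdb] using hw) rfl
    have e3 : Equiv.swap a b * Equiv.swap c d = Equiv.swap c d * Equiv.swap a b :=
      (Equiv.Perm.disjoint_swap_swap (by simp [ne, ne', hcan.symm, hcb.symm, Ne.symm hda, hdb.symm])).commute
    rw [he, e1, e2, mul_assoc, mul_assoc, e3,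
      dividedDifference_comm ne' ne hcan hcb hda hdb]

/-- Divided differences of Schubert polynomials at an ascent. -/
theorem dividedDifference_schubertPolynomial_of_ascent (w : Equiv.Perm (Fin n)) {a b : Fin n}
    (hab : (a : ℕ) + 1 = b) (h : w a < w b) :
    dividedDifference a b (schubertPolynomial w) = 0 := by
  rw [schubertPolynomial_of_ascent w hab h]
  exact dividedDifference_dividedDifference (by rintro rfl; omega) _

/-- `w` is decreasing except that the entry in position `r` may be too large for its
position. -/
structure IsAlmostReversed (w : Equiv.Perm (Fin n)) (r : Fin n) : Prop where
  anti_lt : ∀ a b, a < b → b < r → w b < w a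
  anti_ge : ∀ a b, r ≤ a → a < b → w b < w a
  cross : ∀ a b, a < r → r < b → w b < w a

theorem IsAlmostReversed.mul_swap {w : Equiv.Perm (Fin n)} {a b : Fin n}
    (hw : IsAlmostReversed w b) (hab : (a : ℕ) + 1 = b) (h : w a < w b) :
    IsAlmostReversed (w * Equiv.swap a b) a := by
  have hsw : ∀ x, x ≠ a → x ≠ b → Equiv.swap a b x = x := fun x =>
    Equiv.swap_apply_of_ne_of_ne
  refine ⟨fun x y hxy hy => ?_, fun x y hx hxy => ?_, fun x y hx hy => ?_⟩
  · simp only [Equiv.Perm.mul_apply]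
    rw [hsw x (by omega) (by omega), hsw y (by omega) (by omega)]
    exact hw.anti_lt x y hxy (by omega)
  · simp only [Equiv.Perm.mul_apply]
    rcases eq_or_lt_of_le hx with rfl | hx
    · rw [Equiv.swap_apply_left]
      rcases eq_or_ne y b with rfl | hy
      · rwa [Equiv.swap_apply_right]
      · rw [hsw y (by omega) hy]
        exact hw.anti_ge b y le_rfl (by omega)
    · rcases eq_or_ne x b with rfl | hxb
      · rw [Equiv.swap_apply_right, hsw y (by omega) (by omega)]
        exact hw.cross a y (by omega) hxy
      · rw [hsw x (by omega) hxb, hsw y (by omega) (by omega)]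
        exact hw.anti_ge x y (by omega) hxy
  · simp only [Equiv.Perm.mul_apply]
    rw [hsw x (by omega) (by omega)]
    rcases eq_or_ne y b with rfl | hyb
    · rw [Equiv.swap_apply_right]
      exact hw.anti_lt x a hx (by omega)
    · rw [hsw y (by omega) hyb]
      exact hw.cross x y (by omega) (by omega)

/-- The monomial is x_a times a polynomial symmetric in x_a and x_b, so the divided difference just
strips x_a. -/
theorem dividedDifference_prod_X_pow {a b : Fin n} (hab : a ≠ b) (d : Fin n → ℕ)
    (h : d a = d b + 1) :
    ∏ i, (X i : MvPolynomial (Fin n) ℤ) ^ d i =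
        X a * dividedDifference a b (∏ i, X i ^ d i) ∧
      dividedDifference a b (∏ i, (X i : MvPolynomial (Fin n) ℤ) ^ d i) =
        ∏ i, X i ^ (Function.update d a (d b) i) := by
  set e := Function.update d a (d b) with he
  have hea : e a = d b := by simp [he]
  have heb : e b = d b := by simp [he, hab.symm]
  have h1 : ∏ i, (X i : MvPolynomial (Fin n) ℤ) ^ d i = X a * ∏ i, X i ^ e i := by
    rw [← Finset.mul_prod_erase _ _ (Finset.mem_univ a),
      ← Finset.mul_prod_erase _ (fun i => (X i : MvPolynomial (Fin n) ℤ) ^ e i)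
        (Finset.mem_univ a), hea, h, ← mul_assoc, ← pow_succ']
    congr 1
    refine Finset.prod_congr rfl fun i hi => ?_
    rw [he, Function.update_of_ne (Finset.ne_of_mem_erase hi)]
  have h2 : rename (Equiv.swap a b) (∏ i, (X i : MvPolynomial (Fin n) ℤ) ^ e i) =
      ∏ i, X i ^ e i := by
    rw [map_prod]
    simp only [map_pow, rename_X]
    refine Fintype.prod_equiv (Equiv.swap a b) _ _ fun i => ?_
    rcases eq_or_ne i a with rfl | ha
    · rw [Equiv.swap_apply_left, hea, heb]
    · rcases eq_or_ne i b with rfl | hb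
      · rw [Equiv.swap_apply_right, hea, heb]
      · rw [Equiv.swap_apply_of_ne_of_ne ha hb]
  have h3 : dividedDifference a b (∏ i, (X i : MvPolynomial (Fin n) ℤ) ^ d i) =
      ∏ i, X i ^ e i := by
    rw [h1, dividedDifference_mul hab, dividedDifference_eq_zero hab h2,
      dividedDifference_X_left hab, mul_zero, add_zero, one_mul]
  exact ⟨by rw [h3, h1], h3⟩

/-- Such a permutation comes from the reversed one by carrying an entry to the right up to position
r, and every step strips one variable from a monomial. The last clause is what stability needs. -/
theorem IsAlmostReversed.schubertPolynomial_eq {w : Equiv.Perm (Fin n)} {r : Fin n}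
    (hw : IsAlmostReversed w r) :
    ∃ d : Fin n → ℕ, schubertPolynomial w = ∏ i, X i ^ d i ∧
      (∀ i, r ≤ i → d i = n - 1 - i) ∧
      ((w r : ℕ) + 1 = n → ∀ i, i < r → d i = n - 2 - i) := by
  obtain ⟨r, hr⟩ := r
  induction r generalizing w with
  | zero =>
    refine ⟨_, schubertPolynomial_of_no_ascent w fun a b hab =>
      hw.anti_ge a b (Fin.mk_le_of_le_val (Nat.zero_le _)) (by omega), fun _ _ => rfl,
      fun _ i hi => absurd hi (by simp [Fin.lt_def])⟩
  | succ r ih =>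
    set a : Fin n := ⟨r, by omega⟩
    set b : Fin n := ⟨r + 1, hr⟩
    have hab : (a : ℕ) + 1 = b := rfl
    have ha : (a : ℕ) = r := rfl
    have ne : a ≠ b := by intro h; have := Fin.ext_iff.mp h; omega
    rcases lt_or_gt_of_ne (w.injective.ne ne) with h | h
    · obtain ⟨d, h1, h2, h3⟩ := ih _ (hw.mul_swap hab h)
      have hda := h2 a le_rfl
      have hdb := h2 b (by omega)
      have key := (dividedDifference_prod_X_pow ne d (by omega)).2
      rw [← h1, ← schubertPolynomial_of_ascent w hab h] at key
      refine ⟨_, key, fun i hi => ?_, fun hl i hi => ?_⟩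
      · rw [Function.update_of_ne (by omega)]
        exact h2 i (by omega)
      · rcases eq_or_ne i a with rfl | hia
        · rw [Function.update_self]
          omega
        · rw [Function.update_of_ne hia]
          exact h3 (by simpa using hl) i (by omega)
    · refine ⟨_, schubertPolynomial_of_no_ascent w fun x y hxy => ?_, fun _ _ => rfl,
        fun hl => ?_⟩
      · rcases lt_trichotomy y b with hy | rfl | hy
        · exact hw.anti_lt x y (by omega) hy
        · obtain rfl : x = a := Fin.ext (by omega)
          exact h
        · exact hw.anti_ge x y (by omega) (by omega)
      · have := (w a).2
        rw [Fin.lt_def] at h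
        omega

/-- For an almost reversed permutation, passing to the neighbour is multiplication by a
variable. -/
theorem IsAlmostReversed.schubertPolynomial_mul_swap {w : Equiv.Perm (Fin n)} {a b : Fin n}
    (hw : IsAlmostReversed w b) (hab : (a : ℕ) + 1 = b) (h : w a < w b) :
    schubertPolynomial (w * Equiv.swap a b) = X a * schubertPolynomial w := by
  obtain ⟨d, h1, h2, -⟩ := (hw.mul_swap hab h).schubertPolynomial_eq
  have ne : a ≠ b := by intro h; have := Fin.ext_iff.mp h; omega
  have hda := h2 a le_rfl
  have hdb := h2 b (by omega)
  have := (dividedDifference_prod_X_pow ne d (by omega)).1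
  rwa [← h1, ← schubertPolynomial_of_ascent w hab h] at this

end Schubert

/-! ### Monk's formula -/

section Monk

variable {n : ℕ}

/-- Exchanging the entries in positions `i < j` creates exactly one inversion. -/
def IsCover (u : Equiv.Perm (Fin n)) (i j : Fin n) : Prop :=
  i < j ∧ u i < u j ∧ ∀ c, i < c → c < j → ¬(u i < u c ∧ u c < u j)

open Classical in
/-- The coefficient of `𝔖_{u (r j)}` in Monk's expansion of `x_r 𝔖_u`. -/
noncomputable def monkCoeff (u : Equiv.Perm (Fin n)) (r j : Fin n) : ℤ :=
  if IsCover u r j then 1 else if IsCover u j r then -1 else 0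

theorem monkCoeff_comm (u : Equiv.Perm (Fin n)) (r j : Fin n) :
    monkCoeff u j r = -monkCoeff u r j := by
  unfold monkCoeff
  have : ¬(IsCover u r j ∧ IsCover u j r) := fun h => h.1.1.asymm h.2.1
  split_ifs <;> simp_all

/-- Matches the terms of Monk's formula for u with those terms for u(a b) that survive the divided
difference: since u(a b) times the conjugate of (i j) is u(i j)(a b), survival means an ascent of
u(i j) at a, b. -/
theorem isCover_mul_swap_iff {u : Equiv.Perm (Fin n)} {a b i j : Fin n}
    (hab : (a : ℕ) + 1 = b) (h : u a < u b) (hij : ¬(i = a ∧ j = b)) (hij' : ¬(i = b ∧ j = a)) :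
    (IsCover (u * Equiv.swap a b) (Equiv.swap a b i) (Equiv.swap a b j) ∧
      (u * Equiv.swap i j) a < (u * Equiv.swap i j) b) ↔ IsCover u i j := by
  have ne : a ≠ b := by intro h; have := Fin.ext_iff.mp h; omega
  have hlt : ∀ x y : Fin n, ¬(x = a ∧ y = b) → ¬(x = b ∧ y = a) →
      (Equiv.swap a b x < Equiv.swap a b y ↔ x < y) := by
    intro x y h1 h2
    simp only [Equiv.swap_apply_def]
    split_ifs <;> omega
  have hsa : Equiv.swap a b a = b := Equiv.swap_apply_left a b
  have hsb : Equiv.swap a b b = a := Equiv.swap_apply_right a b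
  have hba : a < b := by rw [Fin.lt_def]; omega
  have hv : ∀ x, (u * Equiv.swap i j) x = if x = i then u j else if x = j then u i else u x := by
    intro x
    rw [Equiv.Perm.mul_apply, Equiv.swap_apply_def]
    split_ifs <;> rfl
  have inj : ∀ x y, u x = u y → x = y := fun x y e => u.injective e
  have hbet : ∀ x, ¬(a < x ∧ x < b) := by intro x; simp only [Fin.lt_def]; omega
  rw [hv, hv]
  unfold IsCover
  rw [(Equiv.swap a b).surjective.forall]
  simp only [Equiv.Perm.mul_apply, Equiv.swap_apply_self, hlt i j hij hij']
  constructor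
  · rintro ⟨⟨h1, h2, h3⟩, h4⟩
    refine ⟨h1, h2, fun c hc1 hc2 hc => ?_⟩
    have h3c := h3 c
    grind
  · rintro ⟨h1, h2, h3⟩
    refine ⟨⟨h1, h2, fun c hc1 hc2 hc => ?_⟩, ?_⟩
    · have h3c := h3 c
      grind
    · have h3a := h3 a
      have h3b := h3 b
      grind

/-- If u(r j) ascends at a, b, this is the defining recursion. Otherwise the polynomial on the left
is symmetric in x_a, x_b, and the coefficient on the right vanishes by `isCover_mul_swap_iff`. -/
theorem dividedDifference_monk_term {u : Equiv.Perm (Fin n)} {a b r j : Fin n}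
    (hab : (a : ℕ) + 1 = b) (h : u a < u b) (hrj : ¬(r = a ∧ j = b)) (hrj' : ¬(r = b ∧ j = a)) :
    dividedDifference a b
        (monkCoeff (u * Equiv.swap a b) (Equiv.swap a b r) (Equiv.swap a b j) •
          schubertPolynomial (u * Equiv.swap a b *
            Equiv.swap (Equiv.swap a b r) (Equiv.swap a b j))) =
      monkCoeff u r j • schubertPolynomial (u * Equiv.swap r j) := by
  have ne : a ≠ b := by intro h; have := Fin.ext_iff.mp h; omega
  have e : u * Equiv.swap a b * Equiv.swap (Equiv.swap a b r) (Equiv.swap a b j) =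
      u * Equiv.swap r j * Equiv.swap a b := by
    rw [Equiv.swap_apply_apply, Equiv.swap_inv]
    simp only [mul_assoc]
    rw [Equiv.swap_mul_self_mul]
  have hsmul : ∀ (m : ℤ) f, dividedDifference a b (m • f) = m • dividedDifference a b f :=
    fun m f => map_zsmul (dividedDifferenceHom ne) m f
  rw [hsmul, e]
  have c1 := isCover_mul_swap_iff hab h hrj hrj'
  have c2 := isCover_mul_swap_iff (i := j) (j := r) hab h (fun e => hrj' e.symm)
    (fun e => hrj e.symm)
  rw [Equiv.swap_comm j r] at c2
  rcases lt_or_gt_of_ne ((u * Equiv.swap r j).injective.ne ne) with hv | hv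
  · rw [schubertPolynomial_of_ascent (u * Equiv.swap r j) hab hv]
    congr 1
    simp only [hv, and_true] at c1 c2
    classical exact if_congr c1 rfl (if_congr c2 rfl rfl)
  · rw [dividedDifference_schubertPolynomial_of_ascent _ hab (by simpa using hv), smul_zero]
    simp only [hv.asymm, and_false, false_iff] at c1 c2
    simp [monkCoeff, c1, c2]

/-- Apply the divided difference to the formula for u(a b). The Leibniz term in which the variable
is differentiated is S_{u(a b)} up to sign if r is a or b, and zero otherwise; it supplies exactly
the summand which exchanges a and b. -/
theorem monk_step {u : Equiv.Perm (Fin n)} {a b r : Fin n}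
    (hab : (a : ℕ) + 1 = b) (h : u a < u b)
    (ih : X (Equiv.swap a b r) * schubertPolynomial (u * Equiv.swap a b) =
      ∑ j, monkCoeff (u * Equiv.swap a b) (Equiv.swap a b r) j •
        schubertPolynomial (u * Equiv.swap a b * Equiv.swap (Equiv.swap a b r) j)) :
    X r * schubertPolynomial u =
      ∑ j, monkCoeff u r j • schubertPolynomial (u * Equiv.swap r j) := by
  have ne : a ≠ b := by intro h; have := Fin.ext_iff.mp h; omega
  have hcov : IsCover u a b := ⟨by rw [Fin.lt_def]; omega, h, fun c h1 h2 => by omega⟩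
  have hcov' : ¬IsCover u b a := fun hc => hcov.1.asymm hc.1
  have hn1 : monkCoeff (u * Equiv.swap a b) a b = 0 := by
    rw [monkCoeff, if_neg (fun hc => ?_), if_neg fun hc => ?_]
    · exact hcov.1.asymm hc.1
    · exact absurd hc.2.1 (by simpa using h.le)
  have hn2 : monkCoeff (u * Equiv.swap a b) b a = 0 := by
    rw [monkCoeff_comm, hn1, neg_zero]
  have key := congrArg (dividedDifferenceHom ne) ih
  rw [map_sum, ← Equiv.sum_comp (Equiv.swap a b)] at key
  change dividedDifference a b _ = ∑ j, dividedDifference a b _ at key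
  have hD : dividedDifference a b (schubertPolynomial (u * Equiv.swap a b)) =
      schubertPolynomial u := (schubertPolynomial_of_ascent u hab h).symm
  have h0 : dividedDifference a b (0 : MvPolynomial (Fin n) ℤ) = 0 :=
    map_zero (dividedDifferenceHom ne)
  rw [dividedDifference_mul ne, hD] at key
  rcases eq_or_ne r a with rfl | hra
  · rw [Equiv.swap_apply_left, dividedDifference_X_right ne, rename_X,
      Equiv.swap_apply_right, ← Finset.add_sum_erase _ _ (Finset.mem_univ b),
      Equiv.swap_apply_right, hn2, zero_smul, h0] at key
    rw [← Finset.add_sum_erase _ _ (Finset.mem_univ b), monkCoeff, if_pos hcov, one_smul,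
      ← sub_eq_iff_eq_add']
    rw [zero_add, neg_one_mul, neg_add_eq_sub] at key
    rw [key]
    refine Finset.sum_congr rfl fun j hj => ?_
    rw [← dividedDifference_monk_term hab h (fun e => Finset.ne_of_mem_erase hj e.2)
      (fun e => ne e.1), Equiv.swap_apply_left]
  rcases eq_or_ne r b with rfl | hrb
  · rw [Equiv.swap_apply_right, dividedDifference_X_left ne, rename_X,
      Equiv.swap_apply_left, ← Finset.add_sum_erase _ _ (Finset.mem_univ a),
      Equiv.swap_apply_left, hn1, zero_smul, h0] at key
    rw [← Finset.add_sum_erase _ _ (Finset.mem_univ a), monkCoeff, if_neg hcov', if_pos hcov,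
      Equiv.swap_comm r a, neg_smul, one_smul, neg_add_eq_sub, eq_sub_iff_add_eq]
    rw [zero_add, one_mul, add_comm] at key
    rw [key]
    refine Finset.sum_congr rfl fun j hj => ?_
    rw [← dividedDifference_monk_term hab h (fun e => ne e.1.symm)
      (fun e => Finset.ne_of_mem_erase hj e.2), Equiv.swap_apply_right]
  · rw [Equiv.swap_apply_of_ne_of_ne hra hrb, dividedDifference_X_of_ne ne hra hrb, zero_mul,
      zero_add, rename_X, Equiv.swap_apply_of_ne_of_ne hra hrb] at key
    rw [key]
    refine Finset.sum_congr rfl fun j hj => ?_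
    rw [← dividedDifference_monk_term hab h (fun e => hra e.1) (fun e => hrb e.1),
      Equiv.swap_apply_of_ne_of_ne hra hrb]

/-- **Monk's formula**, in the form of an expansion of `x_r 𝔖_u`; the hypothesis says that no
permutation of a larger set is needed. -/
theorem monk (u : Equiv.Perm (Fin n)) (r : Fin n) (hr : ∃ j, r < j ∧ u r < u j) :
    X r * schubertPolynomial u =
      ∑ j, monkCoeff u r j • schubertPolynomial (u * Equiv.swap r j) := by
  induction hN : (nonInversions u).card using Nat.strong_induction_on generalizing u r with
  | _ N IH =>
  subst hN
  obtain ⟨j, hrj, huj⟩ := hr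
  -- The hypothesis passes to u(a b) and the moved positions unless the pair (r, j) is (a, b)
  -- itself.
  by_cases hex : ∃ a b : Fin n, (a : ℕ) + 1 = b ∧ u a < u b ∧
      ∃ j, r < j ∧ u r < u j ∧ ¬(r = a ∧ j = b)
  · obtain ⟨a, b, hab, h, j, hrj, huj, hne⟩ := hex
    refine monk_step hab h (IH _ (nonInversions_mul_swap_card_lt u hab h) _ _
      ⟨Equiv.swap a b j, ?_, by simpa using huj⟩ rfl)
    simp only [Equiv.swap_apply_def]
    split_ifs <;> omega
  -- Now r, r+1 is the only ascent, and no entry beyond r+1 exceeds u(r). Hence u is almost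
  -- reversed, and the expansion has a single term.
  · push Not at hex
    have hr1 : (r : ℕ) + 1 < n := by omega
    set b : Fin n := ⟨r + 1, hr1⟩ with hb
    have hrb : (r : ℕ) + 1 = b := rfl
    have hdec : ∀ x y : Fin n, (x : ℕ) + 1 = y → x ≠ r → u y < u x := by
      intro x y hxy hxr
      by_contra hc
      have hxy' : u x < u y := lt_of_le_of_ne (not_lt.mp hc)
        (u.injective.ne (by rintro rfl; omega))
      exact hxr (hex x y hxy hxy' j hrj huj).1.symm
    have hbig : ∀ y, b < y → u y < u r := by
      intro y hy
      by_contra hc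
      have hry : u r < u y := lt_of_le_of_ne (not_lt.mp hc)
        (u.injective.ne (by rintro rfl; omega))
      by_cases hrb' : u r < u b
      · exact hy.ne' (hex r b hrb hrb' y (by omega) hry).2
      · have : u b < u y := (not_lt.mp hrb').trans_lt hry
        have hmono : ∀ m (hm : m < n), (b : ℕ) ≤ m → u ⟨m, hm⟩ ≤ u b := by
          intro m hm hbm
          induction m, hbm using Nat.le_induction with
          | base => rfl
          | succ m hbm ih =>
            exact (hdec ⟨m, by omega⟩ ⟨m + 1, hm⟩ rfl
              (by intro e; have := Fin.ext_iff.mp e; simp only at this; omega)).le.trans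
              (ih (by omega))
        exact absurd this (not_lt.mpr (hmono y y.2 hy.le))
    have hub : u r < u b := by
      rcases eq_or_lt_of_le (show b ≤ j by rw [Fin.le_def]; omega) with rfl | hlt
      · exact huj
      · exact absurd (hbig j hlt) huj.asymm
    have hchain : ∀ x : Fin n, ∀ m (hm : m < n), (x : ℕ) < m → ((m : ℕ) ≤ r ∨ b ≤ x) →
        u ⟨m, hm⟩ < u x := by
      intro x m hm hxm
      induction m, hxm using Nat.le_induction with
      | base =>
        intro hc
        exact hdec x ⟨x + 1, hm⟩ rfl (by rintro rfl; omega)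
      | succ m hxm ih =>
        intro hc
        refine (hdec ⟨m, by omega⟩ ⟨m + 1, hm⟩ rfl ?_).trans (ih (by omega) (by omega))
        intro e; have := Fin.ext_iff.mp e; simp only at this; omega
    have hrev : IsAlmostReversed u b := by
      refine ⟨fun x y hxy hy => hchain x y y.2 hxy (by omega),
        fun x y hx hxy => hchain x y y.2 hxy (Or.inr hx), fun x y hx hy => ?_⟩
      rcases eq_or_ne x r with rfl | hxr
      · exact hbig y hy
      · exact (hbig y hy).trans (hchain x r r.2 (by omega) (Or.inl le_rfl))
    rw [← hrev.schubertPolynomial_mul_swap hrb hub,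
      Finset.sum_eq_single_of_mem b (Finset.mem_univ b), monkCoeff, if_pos, one_smul]
    · exact ⟨by rw [Fin.lt_def]; omega, hub, fun c h1 h2 => by omega⟩
    · intro y _ hy
      rw [monkCoeff, if_neg, if_neg, zero_smul]
      · rintro ⟨h1, h2, -⟩
        exact h2.asymm (hchain y r r.2 h1 (Or.inl le_rfl))
      · rintro ⟨h1, h2, -⟩
        exact h2.asymm (hbig y (by omega))

end Monk

/-! ### Stability -/

section Stability

variable {n : ℕ}

/-- The extension of a permutation by a fixed point at the end. -/
def extendPerm (w : Equiv.Perm (Fin n)) : Equiv.Perm (Fin (n + 1)) :=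
  finSuccEquivLast.symm.permCongr (Equiv.optionCongr w)

@[simp]
theorem extendPerm_castSucc (w : Equiv.Perm (Fin n)) (i : Fin n) :
    extendPerm w i.castSucc = (w i).castSucc := by
  simp [extendPerm, Equiv.permCongr_apply]

@[simp]
theorem extendPerm_last (w : Equiv.Perm (Fin n)) :
    extendPerm w (Fin.last n) = Fin.last n := by
  simp [extendPerm, Equiv.permCongr_apply]

theorem extendPerm_mul (v w : Equiv.Perm (Fin n)) :
    extendPerm (v * w) = extendPerm v * extendPerm w := by
  ext i
  refine Fin.lastCases ?_ (fun i => ?_) i <;> simp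

theorem extendPerm_inv (w : Equiv.Perm (Fin n)) : extendPerm w⁻¹ = (extendPerm w)⁻¹ := by
  rw [eq_inv_iff_mul_eq_one, ← extendPerm_mul, inv_mul_cancel]
  ext i
  refine Fin.lastCases ?_ (fun i => ?_) i <;> simp

theorem extendPerm_swap (a b : Fin n) :
    extendPerm (Equiv.swap a b) = Equiv.swap a.castSucc b.castSucc := by
  ext i
  refine Fin.lastCases ?_ (fun i => ?_) i
  · rw [extendPerm_last, Equiv.swap_apply_of_ne_of_ne (Fin.castSucc_ne_last a).symm
      (Fin.castSucc_ne_last b).symm]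
  · rw [extendPerm_castSucc, (Fin.castSucc_injective n).map_swap]

/-- Divided differences commute with renaming, which reduces to the reversed permutation. Its
extension is almost reversed with the largest entry in the last position, so both sides are the same
monomial. -/
theorem schubertPolynomial_extendPerm (w : Equiv.Perm (Fin n)) :
    schubertPolynomial (extendPerm w) = rename Fin.castSucc (schubertPolynomial w) := by
  induction hN : (nonInversions w).card using Nat.strong_induction_on generalizing w with
  | _ N IH =>
  subst hN
  by_cases hex : ∃ a b : Fin n, (a : ℕ) + 1 = b ∧ w a < w b
  · obtain ⟨a, b, hab, h⟩ := hex
    have ne : a ≠ b := by intro h; have := Fin.ext_iff.mp h; omega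
    rw [schubertPolynomial_of_ascent w hab h, rename_dividedDifference
      (Fin.castSucc_injective n) ne, ← IH _ (nonInversions_mul_swap_card_lt w hab h) _ rfl,
      extendPerm_mul, extendPerm_swap]
    exact schubertPolynomial_of_ascent (extendPerm w) (by simpa using hab) (by simpa using h)
  · push Not at hex
    have hdec : ∀ a b : Fin n, (a : ℕ) + 1 = b → w b < w a := fun a b hab =>
      lt_of_le_of_ne (hex a b hab) (w.injective.ne (by rintro rfl; omega))
    have hanti : ∀ x : Fin n, ∀ m (hm : m < n), (x : ℕ) < m → w ⟨m, hm⟩ < w x := by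
      intro x m hm hxm
      induction m, hxm using Nat.le_induction with
      | base => exact hdec x ⟨x + 1, hm⟩ rfl
      | succ m hxm ih =>
        exact (hdec ⟨m, by omega⟩ ⟨m + 1, hm⟩ rfl).trans (ih (by omega))
    have hrev : IsAlmostReversed (extendPerm w) (Fin.last n) := by
      refine ⟨fun x y hxy hy => ?_, fun x y hx hxy => ?_, fun x y hx hy => ?_⟩
      · obtain ⟨y, rfl⟩ := Fin.exists_castSucc_eq.mpr hy.ne
        obtain ⟨x, rfl⟩ := Fin.exists_castSucc_eq.mpr (hxy.trans hy).ne
        simpa using hanti x y y.2 (by simpa using hxy)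
      · exact absurd (hx.trans_lt hxy) (Fin.le_last y).not_gt
      · exact absurd hy (Fin.le_last y).not_gt
    obtain ⟨d, h1, h2, h3⟩ := hrev.schubertPolynomial_eq
    rw [h1, schubertPolynomial_of_no_ascent w hdec, map_prod, Fin.prod_univ_castSucc,
      h2 _ le_rfl]
    simp only [map_pow, rename_X, Fin.val_last, add_tsub_cancel_right, tsub_self, pow_zero,
      mul_one]
    refine Finset.prod_congr rfl fun i _ => ?_
    rw [h3 (by simp) _ (Fin.castSucc_lt_last i)]
    congr 1

theorem schubertPolynomial_one : schubertPolynomial (1 : Equiv.Perm (Fin n)) = 1 := by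
  induction n with
  | zero => rw [schubertPolynomial_of_no_ascent _ fun a => a.elim0]; simp
  | succ n ih =>
    have : (1 : Equiv.Perm (Fin (n + 1))) = extendPerm 1 := by
      ext i
      refine Fin.lastCases ?_ (fun i => ?_) i <;> simp
    rw [this, schubertPolynomial_extendPerm, ih, map_one]

end Stability

/-! ### The transition formula -/

section Transition

variable {n : ℕ}

/-- The situation of the transition formula: `u` is increasing after position `r`, and `s` is the
first later position with an entry larger than `u r`. -/
structure IsTransition (u : Equiv.Perm (Fin n)) (r s : Fin n) : Prop where
  lt : r < s
  inc : ∀ a b, r < a → a < b → u a < u b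
  val_lt : u r < u s
  val_gt : ∀ a, r < a → a < s → u a < u r

theorem IsTransition.isCover {u : Equiv.Perm (Fin n)} {r s : Fin n} (h : IsTransition u r s) :
    IsCover u r s :=
  ⟨h.lt, h.val_lt, fun c h1 h2 hc => (h.val_gt c h1 h2).asymm hc.1⟩

open Classical in
/-- The positions `i < r` such that exchanging the entries in positions `i` and `r` creates
exactly one inversion. -/
noncomputable def coverPositions (u : Equiv.Perm (Fin n)) (r : Fin n) : Finset (Fin n) :=
  Finset.univ.filter fun i => IsCover u i r

theorem mem_coverPositions {u : Equiv.Perm (Fin n)} {r i : Fin n} :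
    i ∈ coverPositions u r ↔ IsCover u i r := by
  simp [coverPositions]

/-- Since u increases after r, the only positive term in Monk's expansion of x_r S_u is that of s.
The negative terms are moved to the other side. -/
theorem IsTransition.schubertPolynomial_eq {u : Equiv.Perm (Fin n)} {r s : Fin n}
    (h : IsTransition u r s) :
    schubertPolynomial (u * Equiv.swap r s) = X r * schubertPolynomial u +
      ∑ i ∈ coverPositions u r, schubertPolynomial (u * Equiv.swap i r) := by
  classical
  have hs : s ∉ coverPositions u r := fun hc => h.lt.asymm (mem_coverPositions.mp hc).1
  have h0 : ∀ j, j ∉ insert s (coverPositions u r) → monkCoeff u r j = 0 := by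
    intro j hj
    rw [Finset.mem_insert, not_or, mem_coverPositions] at hj
    rw [monkCoeff, if_neg, if_neg hj.2]
    rintro ⟨h1, h2, h3⟩
    rcases lt_or_gt_of_ne hj.1 with hjs | hjs
    · exact h2.asymm (h.val_gt j h1 hjs)
    · exact h3 s h.lt hjs ⟨h.val_lt, h.inc s j h.lt hjs⟩
  rw [monk u r ⟨s, h.lt, h.val_lt⟩,
    ← Finset.sum_subset (Finset.subset_univ (insert s (coverPositions u r)))
      (fun j _ hj => by rw [h0 j hj, zero_smul]),
    Finset.sum_insert hs, monkCoeff, if_pos h.isCover, one_smul, add_assoc,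
    ← Finset.sum_add_distrib, Finset.sum_eq_zero, add_zero]
  intro i hi
  have hi' := mem_coverPositions.mp hi
  rw [monkCoeff_comm u i r, monkCoeff, if_pos hi', Equiv.swap_comm, neg_smul, one_smul,
    neg_add_cancel]

/-- In the sum of Monk's formulas over all positions but the last, terms exchanging two of these
positions cancel by antisymmetry. Among the exchanges with the last position, the fixed point just
before it leaves only one cover. -/
theorem schubertPolynomial_extendPerm_mul_swap (u : Equiv.Perm (Fin n)) :
    schubertPolynomial (extendPerm (extendPerm u) *
        Equiv.swap (Fin.last n).castSucc (Fin.last (n + 1))) =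
      ∑ q : Fin (n + 1), X q.castSucc * schubertPolynomial (extendPerm (extendPerm u)) := by
  set v := extendPerm (extendPerm u) with hv
  have h1 : ∀ q : Fin (n + 1), X q.castSucc * schubertPolynomial v =
      ∑ j, monkCoeff v q.castSucc j • schubertPolynomial (v * Equiv.swap q.castSucc j) :=
    fun q => monk v _ ⟨Fin.last (n + 1), Fin.castSucc_lt_last q, by
      rw [hv, extendPerm_last, extendPerm_castSucc]; exact Fin.castSucc_lt_last _⟩
  simp only [h1, Fin.sum_univ_castSucc (n := n + 1), Finset.sum_add_distrib]
  have h2 : ∑ q : Fin (n + 1), ∑ j : Fin (n + 1), monkCoeff v q.castSucc j.castSucc •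
      schubertPolynomial (v * Equiv.swap q.castSucc j.castSucc) = 0 := by
    refine self_eq_neg.mp ?_
    conv_lhs => rw [Finset.sum_comm]
    rw [← Finset.sum_neg_distrib]
    refine Finset.sum_congr rfl fun q _ => ?_
    rw [← Finset.sum_neg_distrib]
    refine Finset.sum_congr rfl fun j _ => ?_
    rw [monkCoeff_comm, Equiv.swap_comm, neg_smul]
  rw [h2, zero_add, Finset.sum_eq_single_of_mem (Fin.last n) (Finset.mem_univ _), monkCoeff,
    if_pos, one_smul]
  · refine ⟨Fin.castSucc_lt_last _, ?_, fun c h1 h2 => ?_⟩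
    · rw [hv, extendPerm_last, extendPerm_castSucc]; exact Fin.castSucc_lt_last _
    · simp only [Fin.lt_def, Fin.val_castSucc, Fin.val_last] at h1 h2
      omega
  · intro q _ hq
    obtain ⟨q, rfl⟩ := Fin.exists_castSucc_eq.mpr hq
    rw [monkCoeff, if_neg, if_neg, zero_smul]
    · exact fun hc => absurd hc.1 (Fin.le_last _).not_gt
    · rintro ⟨-, -, h3⟩
      refine h3 (Fin.last n).castSucc (by simp) (Fin.castSucc_lt_last _) ?_
      rw [hv, extendPerm_last, extendPerm_castSucc, extendPerm_castSucc, extendPerm_castSucc,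
        extendPerm_last]
      exact ⟨Fin.castSucc_lt_castSucc_iff.mpr (Fin.castSucc_lt_last _), Fin.castSucc_lt_last _⟩

/-- Induction along the transition formula. -/
theorem transition_induction {P : Equiv.Perm (Fin n) → Prop} (one : P 1)
    (step : ∀ u r s, IsTransition u r s → P u → (∀ i, IsCover u i r → P (u * Equiv.swap i r)) →
      P (u * Equiv.swap r s)) (w : Equiv.Perm (Fin n)) : P w := by
  suffices H : ∀ R, R ≤ n → ∀ w : Equiv.Perm (Fin n),
      (∀ a b : Fin n, R ≤ a → a < b → w a < w b) → P w from
    H n le_rfl w fun a b ha => absurd a.2 (not_lt.mpr ha)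
  intro R
  induction R with
  | zero =>
    intro _ w hw
    have : w = 1 := by
      have hm : StrictMono w := fun a b hab => hw a b (Nat.zero_le _) hab
      ext x
      exact congrArg Fin.val (congrFun (congrArg DFunLike.coe
        (Subsingleton.elim (hm.orderIsoOfSurjective w w.surjective) (OrderIso.refl _))) x)
    rw [this]
    exact one
  | succ R ih =>
    intro hR w hw
    set r : Fin n := ⟨R, hR⟩ with hr
    have hrR : (r : ℕ) = R := rfl
    induction hc : w r using WellFoundedLT.induction generalizing w with
    | _ c IH =>
    subst hc
    by_cases hex : ∃ a, r < a ∧ w a < w r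
    -- Undo the exchange of r with the last later position holding a smaller entry. This lowers the
    -- entry in position r, and the permutations u(i r) have a still smaller entry there, so the
    -- inner induction on that entry applies.
    · obtain ⟨s, ⟨hs, hsr⟩, hmax⟩ : ∃ s, (r < s ∧ w s < w r) ∧
          ∀ t, (r < t ∧ w t < w r) → t ≤ s := by
        have := (Finset.univ.filter fun a => r < a ∧ w a < w r).exists_max_image id
          ⟨hex.choose, by simpa using hex.choose_spec⟩
        obtain ⟨s, h1, h2⟩ := this
        exact ⟨s, by simpa using h1, fun t ht => h2 t (by simpa using ht)⟩
      have hu : ∀ x, (w * Equiv.swap r s) x =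
          if x = r then w s else if x = s then w r else w x := by
        intro x
        rw [Equiv.Perm.mul_apply, Equiv.swap_apply_def]
        split_ifs <;> rfl
      have hw' : ∀ a b, r < a → a < b → w a < w b := fun a b ha => hw a b ha
      have inj : ∀ x y, w x = w y → x = y := fun x y e => w.injective e
      have ht : IsTransition (w * Equiv.swap r s) r s := by
        refine ⟨hs, fun a b ha hab => ?_, ?_, fun a ha has => ?_⟩
        · have h1 := hw' a b ha hab
          have h2 := hmax b
          have h3 := inj b r
          have h4 := hw' a s ha
          simp only [hu]
          grind
        · simp only [hu]
          grind
        · have h4 := hw' a s ha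
          simp only [hu]
          grind
      have := step _ r s ht (IH _ (by simpa [hu] using hsr) _ (fun a b ha => ht.inc a b ha) rfl)
        fun i hi => IH _ ?_ _ (fun a b ha hab => ?_) rfl
      · rwa [Equiv.mul_swap_mul_self] at this
      · rw [Equiv.Perm.mul_apply, Equiv.swap_apply_right]
        refine hi.2.1.trans ?_
        simpa [hu] using hsr
      · have hra : r < a := ha
        have hir := hi.1
        rw [Equiv.Perm.mul_apply, Equiv.Perm.mul_apply _ (Equiv.swap i r),
          Equiv.swap_apply_of_ne_of_ne (by omega) (by omega),
          Equiv.swap_apply_of_ne_of_ne (by omega) (by omega)]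
        exact ht.inc a b hra hab
    · push Not at hex
      refine ih (by omega) w fun a b ha hab => ?_
      rcases eq_or_ne a r with rfl | har
      · exact lt_of_le_of_ne (hex b hab) (w.injective.ne hab.ne)
      · exact hw a b (by omega) hab

end Transition

/-! ### Laplace expansion along several rows -/

/-- The determinant is an integral linear combination of products of complementary minors. -/
theorem det_mem_of_forall_mul_det_mem {P Q R : Type*} [Fintype P] [DecidableEq P] [Fintype Q]
    [DecidableEq Q] [CommRing R] (A : Matrix (P ⊕ Q) (P ⊕ Q) R) (W : AddSubgroup R)
    (h : ∀ e : Equiv.Perm (P ⊕ Q), (A.submatrix Sum.inl (e ∘ Sum.inl)).det *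
      (A.submatrix Sum.inr (e ∘ Sum.inr)).det ∈ W) : A.det ∈ W := by
  classical
  set φ := Equiv.Perm.sumCongrHom P Q with hφ
  have hφi : Function.Injective φ := Equiv.Perm.sumCongrHom_injective
  -- Each permutation is uniquely a coset representative times an element of S_P × S_Q, and the sum
  -- over one coset is, up to sign, a product of complementary minors.
  let E : (Equiv.Perm (P ⊕ Q) ⧸ φ.range) × (Equiv.Perm P × Equiv.Perm Q) →
    Equiv.Perm (P ⊕ Q) := fun x => x.1.out * φ x.2
  have hE : Function.Bijective E := by
    constructor
    · rintro ⟨q, x⟩ ⟨q', x'⟩ hx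
      have hx' : q.out * φ x = q'.out * φ x' := hx
      have hq : q = q' := by
        have := congrArg (QuotientGroup.mk (s := φ.range)) hx'
        rwa [QuotientGroup.mk_mul_of_mem _ (show φ x ∈ φ.range from ⟨x, rfl⟩),
          QuotientGroup.mk_mul_of_mem _ (show φ x' ∈ φ.range from ⟨x', rfl⟩),
          QuotientGroup.out_eq', QuotientGroup.out_eq'] at this
      subst hq
      rw [hφi (mul_left_cancel hx')]
    · intro σ
      obtain ⟨⟨_, y, rfl⟩, hy⟩ := QuotientGroup.mk_out_eq_mul φ.range σ
      refine ⟨⟨σ, y⁻¹⟩, ?_⟩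
      simp only [E, hy, map_inv, mul_inv_cancel_right]
  rw [← Matrix.det_transpose, Matrix.det_apply, ← (Equiv.ofBijective E hE).sum_comp,
    Fintype.sum_prod_type]
  refine sum_mem fun q _ => ?_
  have hq : ∑ y : Equiv.Perm P × Equiv.Perm Q,
      Equiv.Perm.sign (Equiv.ofBijective E hE (q, y)) •
        ∏ i, A.transpose (Equiv.ofBijective E hE (q, y) i) i =
      Equiv.Perm.sign q.out • ((A.submatrix Sum.inl (q.out ∘ Sum.inl)).det *
      (A.submatrix Sum.inr (q.out ∘ Sum.inr)).det) := by
    rw [← Matrix.det_transpose, Matrix.det_apply, ← Matrix.det_transpose (Matrix.submatrix _ _ _),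
      Matrix.det_apply, Finset.sum_mul_sum, Finset.smul_sum, Fintype.sum_prod_type]
    refine Finset.sum_congr rfl fun x _ => ?_
    rw [Finset.smul_sum]
    refine Finset.sum_congr rfl fun y _ => ?_
    have : Equiv.Perm.sign (Equiv.ofBijective E hE (q, (x, y))) =
        Equiv.Perm.sign q.out * (Equiv.Perm.sign x * Equiv.Perm.sign y) := by
      simp [E, φ]
    rw [this, mul_smul, smul_mul_smul_comm, Fintype.prod_sum_type]
    simp [E, φ]
  rw [hq]
  rcases Int.units_eq_one_or (Equiv.Perm.sign q.out) with hs | hs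
  · rw [hs, one_smul]
    exact h _
  · rw [hs, Units.neg_smul, one_smul]
    exact neg_mem (h _)

/-! ### Spans of products of minors -/

section Minors

variable {n : ℕ} (k : Type*) [CommRing k]

/-- The minor of the generic lower-triangular matrix on the rows in `S` and the columns given
by `b`. -/
noncomputable def minor (S : Finset (Fin n)) (b : S → Fin n) : FlagRing n k :=
  ((flagMatrix n k).submatrix (fun p : S => (p : Fin n)) b).det

/-- The exponent of the weight of a minor on the columns given by `b`. -/
noncomputable def content {ι : Type*} [Fintype ι] (b : ι → Fin n) : Fin n →₀ ℕ :=
  ∑ p, Finsupp.single (b p) 1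

theorem content_comp_equiv {ι κ : Type*} [Fintype ι] [Fintype κ] (e : ι ≃ κ) (b : κ → Fin n) :
    content (b ∘ e) = content b :=
  e.sum_comp fun p => Finsupp.single (b p) 1

/-- The minors on the rows in `S` of weight `β`. -/
def minorsOfWeight (S : Finset (Fin n)) (β : Fin n →₀ ℕ) : Set (FlagRing n k) :=
  {x | ∃ b : S → Fin n, content b = β ∧ minor k S b = x}

/-- The span of the products over the columns of `D` of minors, of total weight `α`. -/
noncomputable def minorSpan {m : ℕ} (D : Diagram n m) (α : Fin n →₀ ℕ) :
    Submodule k (FlagRing n k) :=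
  Submodule.span k {x | ∃ (g : Fin m → FlagRing n k) (β : Fin m → Fin n →₀ ℕ),
    (∀ j, g j ∈ minorsOfWeight k (D j) (β j)) ∧ ∑ j, β j = α ∧ ∏ j, g j = x}

variable {k}

theorem det_mem_minorsOfWeight {ι : Type*} [Fintype ι] [DecidableEq ι] (S : Finset (Fin n))
    (e : ι ≃ S) (b : ι → Fin n) :
    ((flagMatrix n k).submatrix (fun p => (e p : Fin n)) b).det ∈
      minorsOfWeight k S (content b) := by
  refine ⟨b ∘ e.symm, content_comp_equiv _ _, ?_⟩
  rw [minor, ← Matrix.det_submatrix_equiv_self e, Matrix.submatrix_submatrix]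
  congr 2
  funext x
  simp

theorem prod_mem_minorSpan {m : ℕ} {D : Diagram n m} {α : Fin n →₀ ℕ}
    {g : Fin m → FlagRing n k} {β : Fin m → Fin n →₀ ℕ}
    (hg : ∀ j, g j ∈ minorsOfWeight k (D j) (β j)) (hβ : ∑ j, β j = α) :
    ∏ j, g j ∈ minorSpan k D α :=
  Submodule.subset_span ⟨g, β, hg, hβ, rfl⟩

/-- A product of minors on the union and on the intersection of two sets of rows is a combination
of products of minors on the two sets. -/
theorem mul_mem_of_mem_union_inter {P Q : Finset (Fin n)} {β₁ β₂ : Fin n →₀ ℕ}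
    {x y : FlagRing n k} (hx : x ∈ minorsOfWeight k (P ∪ Q) β₁)
    (hy : y ∈ minorsOfWeight k (P ∩ Q) β₂) (W : AddSubgroup (FlagRing n k))
    (hW : ∀ x' y' γ₁ γ₂, x' ∈ minorsOfWeight k P γ₁ → y' ∈ minorsOfWeight k Q γ₂ →
      γ₁ + γ₂ = β₁ + β₂ → x' * y' ∈ W) : x * y ∈ W := by
  obtain ⟨b, rfl, rfl⟩ := hx
  obtain ⟨b', rfl, rfl⟩ := hy
  -- A row common to P and Q occurs twice: its copy from P goes to the union, its copy from Q to the
  -- intersection.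
  let e₀ : (↥(P ∪ Q) ⊕ ↥(P ∩ Q)) ≃ (P ⊕ Q) :=
    { toFun := Sum.elim
        (fun u => if h : (u : Fin n) ∈ P then Sum.inl ⟨u, h⟩ else
          Sum.inr ⟨u, (Finset.mem_union.mp u.2).resolve_left h⟩)
        (fun i => Sum.inr ⟨i, (Finset.mem_inter.mp i.2).2⟩)
      invFun := Sum.elim
        (fun p => Sum.inl ⟨p, Finset.mem_union_left _ p.2⟩)
        (fun q => if h : (q : Fin n) ∈ P then Sum.inr ⟨q, Finset.mem_inter.mpr ⟨h, q.2⟩⟩ else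
          Sum.inl ⟨q, Finset.mem_union_right _ q.2⟩)
      left_inv := by
        rintro (u | i)
        · by_cases h : (u : Fin n) ∈ P <;> simp [h]
        · have := (Finset.mem_inter.mp i.2).1
          simp [this]
      right_inv := by
        rintro (p | q)
        · simp
        · by_cases h : (q : Fin n) ∈ P <;> simp [h] }
  set M := flagMatrix n k
  let A : Matrix (P ⊕ Q) (↥(P ∪ Q) ⊕ ↥(P ∩ Q)) (FlagRing n k) :=
    Matrix.fromBlocks (M.submatrix (fun p : P => (p : Fin n)) b) 0
      (M.submatrix (fun p : Q => (p : Fin n)) b) (M.submatrix (fun p : Q => (p : Fin n)) b')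
  have hdet : (A.submatrix id e₀.symm).det = minor k (P ∪ Q) b * minor k (P ∩ Q) b' := by
    rw [← Matrix.det_submatrix_equiv_self e₀, Matrix.submatrix_submatrix]
    -- Left multiplication by the unipotent block matrix with corner -`E` subtracts from each common
    -- row of Q its copy in P. This clears the lower left block and leaves the lower right one
    -- alone, because the rows of `Y` in P vanish.
    let E : Matrix ↥(P ∩ Q) ↥(P ∪ Q) (FlagRing n k) :=
      Matrix.of fun i u => if (i : Fin n) = u then 1 else 0
    let Y : Matrix ↥(P ∪ Q) ↥(P ∩ Q) (FlagRing n k) :=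
      Matrix.of fun u i => if (u : Fin n) ∈ P then 0 else M u (b' i)
    have h1 : A.submatrix (id ∘ e₀) (e₀.symm ∘ e₀) =
        Matrix.fromBlocks (M.submatrix (fun p : ↥(P ∪ Q) => (p : Fin n)) b) Y
          (M.submatrix (fun p : ↥(P ∩ Q) => (p : Fin n)) b)
          (M.submatrix (fun p : ↥(P ∩ Q) => (p : Fin n)) b') := by
      rw [Function.id_comp, e₀.symm_comp_self]
      refine Matrix.ext fun x y => ?_
      rcases x with u | i <;> rcases y with v | j
      · by_cases h : (u : Fin n) ∈ P <;> simp [A, e₀, h]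
      · by_cases h : (u : Fin n) ∈ P <;> simp [A, e₀, Y, h]
      · simp [A, e₀]
      · simp [A, e₀]
    have hE : ∀ (i : ↥(P ∩ Q)) (f : ↥(P ∪ Q) → FlagRing n k), ∑ u, E i u * f u =
        f ⟨i, Finset.mem_union_left _ (Finset.mem_inter.mp i.2).1⟩ := by
      intro i f
      rw [Finset.sum_eq_single_of_mem ⟨i, Finset.mem_union_left _ (Finset.mem_inter.mp i.2).1⟩
        (Finset.mem_univ _)]
      · simp [E]
      · intro u _ hu
        have : ¬((i : Fin n) = u) := fun h => hu (Subtype.ext h.symm)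
        simp [E, this]
    have h2 : E * M.submatrix (fun p : ↥(P ∪ Q) => (p : Fin n)) b =
        M.submatrix (fun p : ↥(P ∩ Q) => (p : Fin n)) b := by
      ext1 i v
      rw [Matrix.mul_apply, hE]
      rfl
    have h3 : E * Y = 0 := by
      ext1 i v
      rw [Matrix.mul_apply, hE]
      simp [Y, (Finset.mem_inter.mp i.2).1]
    have h4 : (Matrix.fromBlocks 1 0 (-E) 1).det = 1 := by
      rw [Matrix.det_fromBlocks_zero₁₂, Matrix.det_one, Matrix.det_one, mul_one]
    rw [h1, ← one_mul (Matrix.det _), ← h4, ← Matrix.det_mul, Matrix.fromBlocks_multiply,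
      Matrix.neg_mul, Matrix.neg_mul, h2, h3]
    simp only [Matrix.one_mul, Matrix.zero_mul, add_zero, neg_zero, zero_add, neg_add_cancel]
    rw [Matrix.det_fromBlocks_zero₂₁]
    rfl
  rw [← hdet]
  refine det_mem_of_forall_mul_det_mem _ W fun e => ?_
  -- The columns from `b'` vanish on the rows of P, so only expansions in which P receives columns
  -- from `b` survive.
  by_cases hz : ∃ p i, e₀.symm (e (Sum.inl p)) = Sum.inr i
  · obtain ⟨p, i, hpi⟩ := hz
    rw [Matrix.det_eq_zero_of_column_eq_zero p, zero_mul]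
    · exact zero_mem W
    · intro p'
      simp [A, hpi]
  · push Not at hz
    have hl : ∀ p, ∃ u, e₀.symm (e (Sum.inl p)) = Sum.inl u := by
      intro p
      rcases hp : e₀.symm (e (Sum.inl p)) with u | i
      · exact ⟨u, rfl⟩
      · exact absurd hp (hz p i)
    choose f hf using hl
    refine hW _ _ _ _ ⟨b ∘ f, rfl, ?_⟩ ⟨fun q => Sum.elim b b' (e₀.symm (e (Sum.inr q))), rfl, ?_⟩ ?_
    · rw [minor]
      congr 1
      ext1 p p'
      simp [A, hf, M]
    · rw [minor]
      congr 1
      ext1 p p'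
      rcases h : e₀.symm (e (Sum.inr p')) with u | i <;> simp [A, h, M]
    · have h1 : content b + content b' = content (Sum.elim b b') := by
        simp [content, Fintype.sum_sum_type]
      have h2 : content (Sum.elim b b') = content (Sum.elim b b' ∘ (e.trans e₀.symm)) :=
        (content_comp_equiv _ _).symm
      rw [h1, h2]
      simp [content, Fintype.sum_sum_type, hf]

/-- Replacing two columns by their union and their intersection makes the span of products of
minors smaller. -/
theorem minorSpan_union_inter_le {m : ℕ} {D D' : Diagram n m} {p c : Fin m} (hpc : p ≠ c)
    (hp : D' p = D c ∪ D p) (hc : D' c = D c ∩ D p) (hD : ∀ j, j ≠ p → j ≠ c → D' j = D j)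
    (α : Fin n →₀ ℕ) : minorSpan k D' α ≤ minorSpan k D α := by
  refine Submodule.span_le.mpr ?_
  rintro _ ⟨g, β, hg, rfl, rfl⟩
  have hprod : ∀ f : Fin m → FlagRing n k,
      ∏ j, f j = f p * f c * ∏ j ∈ (Finset.univ.erase p).erase c, f j := by
    intro f
    rw [mul_assoc, Finset.mul_prod_erase _ _ (Finset.mem_erase.mpr ⟨hpc.symm, Finset.mem_univ c⟩),
      Finset.mul_prod_erase _ _ (Finset.mem_univ p)]
  have hsum : ∀ f : Fin m → Fin n →₀ ℕ,
      ∑ j, f j = f p + f c + ∑ j ∈ (Finset.univ.erase p).erase c, f j := by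
    intro f
    rw [add_assoc, Finset.add_sum_erase _ _ (Finset.mem_erase.mpr ⟨hpc.symm, Finset.mem_univ c⟩),
      Finset.add_sum_erase _ _ (Finset.mem_univ p)]
  have hg1 := hg p
  have hg2 := hg c
  rw [hp] at hg1
  rw [hc] at hg2
  rw [hprod, SetLike.mem_coe]
  set r := ∏ j ∈ (Finset.univ.erase p).erase c, g j with hr
  have := mul_mem_of_mem_union_inter hg1 hg2
    (((minorSpan k D (∑ j, β j)).comap (LinearMap.mulRight k r)).toAddSubgroup)
    fun x y γ₁ γ₂ hx hy hγ => ?_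
  · exact this
  · change x * y * r ∈ minorSpan k D _
    have hne : ∀ j ∈ (Finset.univ.erase p).erase c, j ≠ c ∧ j ≠ p := fun j hj =>
      ⟨Finset.ne_of_mem_erase hj, Finset.ne_of_mem_erase (Finset.mem_of_mem_erase hj)⟩
    have e1 : x * y * r = ∏ j, Function.update (Function.update g c x) p y j := by
      rw [hprod, Function.update_self, Function.update_of_ne hpc.symm, Function.update_self,
        mul_comm y x, hr]
      congr 1
      refine Finset.prod_congr rfl fun j hj => ?_
      rw [Function.update_of_ne (hne j hj).2, Function.update_of_ne (hne j hj).1]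
    have e2 : ∑ j, Function.update (Function.update β c γ₁) p γ₂ j = ∑ j, β j := by
      rw [hsum, hsum, Function.update_self, Function.update_of_ne hpc.symm, Function.update_self,
        add_comm γ₂ γ₁, hγ]
      congr 1
      refine Finset.sum_congr rfl fun j hj => ?_
      rw [Function.update_of_ne (hne j hj).2, Function.update_of_ne (hne j hj).1]
    rw [e1]
    refine prod_mem_minorSpan (fun j => ?_) e2
    rcases eq_or_ne j p with rfl | hjp
    · simpa using hy
    · rcases eq_or_ne j c with rfl | hjc
      · simpa [hjp] using hx
      · simpa [hjp, hjc, hD j hjp hjc] using hg j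

end Minors

/-! ### Replacing one row by another -/

section ReplaceRow

variable {n : ℕ} (k : Type*) [CommRing k]

theorem flagMatrix_eq_zero {a b : Fin n} (h : a < b) : flagMatrix n k a b = 0 :=
  dif_neg (not_le.mpr h)

/-- The substitution which adds `t` times row `i` to row `r` of the generic matrix. -/
noncomputable def addRowHom (r i : Fin n) :
    FlagRing n k →ₐ[k] Polynomial (FlagRing n k) :=
  aeval fun p => Polynomial.C (X p) +
    if p.1.1 = r then Polynomial.X * Polynomial.C (flagMatrix n k i p.1.2) else 0

/-- Because i < r, row i vanishes wherever row r is forced to vanish, so the substitution acts on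
the whole matrix as the row operation. -/
theorem addRowHom_flagMatrix {r i : Fin n} (hir : i < r) (a b : Fin n) :
    addRowHom k r i (flagMatrix n k a b) = Polynomial.C (flagMatrix n k a b) +
      if a = r then Polynomial.X * Polynomial.C (flagMatrix n k i b) else 0 := by
  by_cases h : b ≤ a
  · have : flagMatrix n k a b = X ⟨(a, b), h⟩ := dif_pos h
    rw [this, addRowHom, aeval_X]
  · rw [flagMatrix_eq_zero k (not_le.mp h), map_zero, map_zero, zero_add]
    split_ifs with har
    · rw [flagMatrix_eq_zero k (hir.trans (har ▸ not_le.mp h)), map_zero, mul_zero]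
    · rfl

/-- Replace `r` by `i` in `S`, if possible. -/
def replaceRow (r i : Fin n) (S : Finset (Fin n)) : Finset (Fin n) :=
  if r ∈ S ∧ i ∉ S then insert i (S.erase r) else S

/-- Whether `r` can be replaced by `i` in `S`. -/
def replaceDegree (r i : Fin n) (S : Finset (Fin n)) : ℕ :=
  if r ∈ S ∧ i ∉ S then 1 else 0

variable {k}

theorem addRowHom_minor {r i : Fin n} (hir : i < r) {S : Finset (Fin n)} (hr : r ∈ S)
    (b : S → Fin n) :
    addRowHom k r i (minor k S b) = Polynomial.C (minor k S b) + Polynomial.X *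
      Polynomial.C (((flagMatrix n k).submatrix (fun p : S => (p : Fin n)) b).updateRow ⟨r, hr⟩
        fun p => flagMatrix n k i (b p)).det := by
  set A := (flagMatrix n k).submatrix (fun p : S => (p : Fin n)) b with hA
  have h1 : (addRowHom k r i).mapMatrix A = (A.map Polynomial.C).updateRow ⟨r, hr⟩
      ((A.map Polynomial.C) ⟨r, hr⟩ +
        (Polynomial.X : Polynomial (FlagRing n k)) •
          fun p => Polynomial.C (flagMatrix n k i (b p))) := by
    refine Matrix.ext fun p q => ?_
    rw [AlgHom.mapMatrix_apply, Matrix.map_apply, hA, Matrix.submatrix_apply,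
      addRowHom_flagMatrix k hir, Matrix.updateRow_apply]
    by_cases hp : p = ⟨r, hr⟩
    · rw [if_pos hp, if_pos (congrArg Subtype.val hp), hp]
      rfl
    · rw [if_neg hp, if_neg fun e => hp (Subtype.ext e), add_zero]
      rfl
  have h2 : (A.map Polynomial.C).det = Polynomial.C A.det := (RingHom.map_det _ _).symm
  have h3 : ((A.map Polynomial.C).updateRow ⟨r, hr⟩
      fun p => Polynomial.C (flagMatrix n k i (b p))).det =
      Polynomial.C (A.updateRow ⟨r, hr⟩ fun p => flagMatrix n k i (b p)).det := by
    rw [RingHom.map_det, RingHom.mapMatrix_apply, Matrix.map_updateRow]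
    rfl
  rw [minor, AlgHom.map_det, h1, Matrix.det_updateRow_add, Matrix.updateRow_eq_self,
    Matrix.det_updateRow_smul, h2, h3]

theorem addRowHom_minor_of_notMem {r i : Fin n} (hir : i < r) {S : Finset (Fin n)} (hr : r ∉ S)
    (b : S → Fin n) : addRowHom k r i (minor k S b) = Polynomial.C (minor k S b) := by
  rw [minor, AlgHom.map_det, RingHom.map_det]
  congr 1
  refine Matrix.ext fun p q => ?_
  rw [AlgHom.mapMatrix_apply, Matrix.map_apply, Matrix.submatrix_apply,
    addRowHom_flagMatrix k hir, if_neg fun e : (p : Fin n) = r => hr (e ▸ p.2), add_zero]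
  rfl

theorem addRowHom_minor_of_mem {r i : Fin n} (hir : i < r) {S : Finset (Fin n)} (hi : i ∈ S)
    (b : S → Fin n) : addRowHom k r i (minor k S b) = Polynomial.C (minor k S b) := by
  by_cases hr : r ∈ S
  · rw [addRowHom_minor hir hr, Matrix.det_zero_of_row_eq (i := ⟨r, hr⟩) (j := ⟨i, hi⟩), map_zero,
      mul_zero, add_zero]
    · exact fun e => hir.ne' (congrArg Subtype.val e)
    · rw [Matrix.updateRow_self, Matrix.updateRow_ne fun e => hir.ne (congrArg Subtype.val e)]
      rfl
  · exact addRowHom_minor_of_notMem hir hr b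

theorem addRowHom_minor_of_not {r i : Fin n} (hir : i < r) {S : Finset (Fin n)}
    (h : ¬(r ∈ S ∧ i ∉ S)) (b : S → Fin n) :
    addRowHom k r i (minor k S b) = Polynomial.C (minor k S b) := by
  by_cases hr : r ∈ S
  · exact addRowHom_minor_of_mem hir (not_not.mp fun hi => h ⟨hr, hi⟩) b
  · exact addRowHom_minor_of_notMem hir hr b

theorem natDegree_addRowHom_le {r i : Fin n} (hir : i < r) {S : Finset (Fin n)}
    {β : Fin n →₀ ℕ} {x : FlagRing n k} (hx : x ∈ minorsOfWeight k S β) :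
    (addRowHom k r i x).natDegree ≤ replaceDegree r i S := by
  obtain ⟨b, -, rfl⟩ := hx
  unfold replaceDegree
  split_ifs with h
  · rw [addRowHom_minor hir h.1]
    compute_degree
  · rw [addRowHom_minor_of_not hir h]
    simp

/-- By linearity in row r, the coefficient of t is the minor with row r replaced by row i.
Transporting rows and columns along the same bijection introduces no sign. -/
theorem exists_coeff_addRowHom_eq {r i : Fin n} (hir : i < r) {S : Finset (Fin n)}
    {β : Fin n →₀ ℕ} {y : FlagRing n k} (hy : y ∈ minorsOfWeight k (replaceRow r i S) β) :
    ∃ x ∈ minorsOfWeight k S β, (addRowHom k r i x).coeff (replaceDegree r i S) = y := by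
  by_cases h : r ∈ S ∧ i ∉ S
  · rw [replaceRow, if_pos h] at hy
    rw [replaceDegree, if_pos h]
    obtain ⟨b, rfl, rfl⟩ := hy
    have hsr : Equiv.swap r i r = i := Equiv.swap_apply_left r i
    have hsi : Equiv.swap r i i = r := Equiv.swap_apply_right r i
    have hsw : ∀ p, p ≠ r → p ≠ i → Equiv.swap r i p = p := fun p =>
      Equiv.swap_apply_of_ne_of_ne
    let e : S ≃ ↥(insert i (S.erase r)) := (Equiv.swap r i).subtypeEquiv fun p => by
      rw [Finset.mem_insert, Finset.mem_erase]
      rcases eq_or_ne p r with rfl | hpr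
      · simp [h.1]
      · rcases eq_or_ne p i with rfl | hpi
        · simp [h.2, hir.ne']
        · rw [hsw p hpr hpi]
          simp [hpr, hpi]
    refine ⟨minor k S (b ∘ e), ⟨b ∘ e, content_comp_equiv e b, rfl⟩, ?_⟩
    rw [addRowHom_minor hir h.1, Polynomial.coeff_add, Polynomial.coeff_C_succ, zero_add,
      Polynomial.coeff_X_mul, Polynomial.coeff_C_zero, minor,
      ← Matrix.det_submatrix_equiv_self e, Matrix.submatrix_submatrix]
    congr 1
    refine Matrix.ext fun p q => ?_
    rw [Matrix.updateRow_apply]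
    by_cases hp : p = ⟨r, h.1⟩
    · rw [if_pos hp, hp]
      simp [e]
    · have hpr : (p : Fin n) ≠ r := fun e => hp (Subtype.ext e)
      have hpi : (p : Fin n) ≠ i := fun e => h.2 (e ▸ p.2)
      rw [if_neg hp]
      simp [e, hsw p hpr hpi]
  · rw [replaceRow, if_neg h] at hy
    obtain ⟨b, rfl, rfl⟩ := hy
    refine ⟨_, ⟨b, rfl, rfl⟩, ?_⟩
    rw [addRowHom_minor_of_not hir h, replaceDegree, if_neg h, Polynomial.coeff_C_zero]

theorem Polynomial.natDegree_prod_le_and_coeff_prod_eq {ι R : Type*} [CommSemiring R]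
    (s : Finset ι) (f : ι → Polynomial R) (d : ι → ℕ) (h : ∀ j, (f j).natDegree ≤ d j) :
    (∏ j ∈ s, f j).natDegree ≤ ∑ j ∈ s, d j ∧
      (∏ j ∈ s, f j).coeff (∑ j ∈ s, d j) = ∏ j ∈ s, (f j).coeff (d j) := by
  classical
  induction s using Finset.induction_on with
  | empty => simp
  | insert a s ha ih =>
    rw [Finset.prod_insert ha, Finset.sum_insert ha, Finset.prod_insert ha]
    exact ⟨Polynomial.natDegree_mul_le_of_le (h a) ih.1,
      by rw [Polynomial.coeff_mul_add_eq_of_natDegree_le (h a) ih.1, ih.2]⟩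

variable (k) in
/-- The coefficient of `t ^ N` after adding `t` times row `i` to row `r`. -/
noncomputable def addRowCoeff (r i : Fin n) (N : ℕ) : FlagRing n k →ₗ[k] FlagRing n k :=
  ((Polynomial.lcoeff (FlagRing n k) N).restrictScalars k).comp (addRowHom k r i).toLinearMap

theorem addRowCoeff_apply (r i : Fin n) (N : ℕ) (x : FlagRing n k) :
    addRowCoeff k r i N x = (addRowHom k r i x).coeff N := rfl

/-- In a product, the coefficient at the sum of the degree bounds is the product of the coefficients
at these bounds, so one linear map replaces r by i in all columns at once. -/
theorem minorSpan_replaceRow_le {m : ℕ} {r i : Fin n} (hir : i < r) (D : Diagram n m)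
    (α : Fin n →₀ ℕ) :
    minorSpan k (fun j => replaceRow r i (D j)) α ≤
      (minorSpan k D α).map (addRowCoeff k r i (∑ j, replaceDegree r i (D j))) := by
  refine Submodule.span_le.mpr ?_
  rintro _ ⟨g, β, hg, rfl, rfl⟩
  choose f hf hfg using fun j => exists_coeff_addRowHom_eq hir (hg j)
  refine ⟨∏ j, f j, prod_mem_minorSpan hf rfl, ?_⟩
  rw [addRowCoeff_apply, map_prod, (Polynomial.natDegree_prod_le_and_coeff_prod_eq _ _ _
    fun j => natDegree_addRowHom_le hir (hf j)).2]
  exact Finset.prod_congr rfl fun j _ => hfg j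

theorem addRowCoeff_eq_zero {m : ℕ} {r i : Fin n} (hir : i < r) {D : Diagram n m}
    {α : Fin n →₀ ℕ} {N : ℕ} (hN : ∑ j, replaceDegree r i (D j) < N) {x : FlagRing n k}
    (hx : x ∈ minorSpan k D α) : addRowCoeff k r i N x = 0 := by
  have : minorSpan k D α ≤ LinearMap.ker (addRowCoeff k r i N) := by
    refine Submodule.span_le.mpr ?_
    rintro _ ⟨g, β, hg, rfl, rfl⟩
    rw [SetLike.mem_coe, LinearMap.mem_ker, addRowCoeff_apply, map_prod]
    exact Polynomial.coeff_eq_zero_of_natDegree_lt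
      ((Polynomial.natDegree_prod_le_and_coeff_prod_eq _ _ _
        fun j => natDegree_addRowHom_le hir (hg j)).1.trans_lt hN)
  exact this hx

/-- The entry z_rr is unchanged by the row operation, since row i is zero in column r. -/
theorem addRowCoeff_flagMatrix_mul {r i : Fin n} (hir : i < r) (N : ℕ) (x : FlagRing n k) :
    addRowCoeff k r i N (flagMatrix n k r r * x) =
      flagMatrix n k r r * addRowCoeff k r i N x := by
  rw [addRowCoeff_apply, map_mul, addRowHom_flagMatrix k hir, if_pos rfl,
    flagMatrix_eq_zero k hir, map_zero, mul_zero, add_zero, Polynomial.coeff_C_mul,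
    addRowCoeff_apply]

end ReplaceRow

/-! ### The transition inequality -/

section Box

variable {n : ℕ} {k : Type*} [CommRing k]

/-- A minor on rows above `r` times an entry of row `r` in column `r`. -/
theorem flagMatrix_mul_mem_minorsOfWeight {r : Fin n} {S : Finset (Fin n)}
    (hS : ∀ a ∈ S, a < r) {β : Fin n →₀ ℕ} {x : FlagRing n k} (hx : x ∈ minorsOfWeight k S β) :
    flagMatrix n k r r * x ∈ minorsOfWeight k (insert r S) (β + Finsupp.single r 1) := by
  obtain ⟨b, rfl, rfl⟩ := hx
  let e : (S ⊕ Unit) ≃ ↥(insert r S) := Equiv.ofBijective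
    (Sum.elim (fun p => ⟨p, Finset.mem_insert_of_mem p.2⟩)
      fun _ => ⟨r, Finset.mem_insert_self r S⟩) (by
    constructor
    · rintro (p | _) (q | _) h
      · exact congrArg Sum.inl (Subtype.ext (congrArg Subtype.val h :))
      · exact absurd (congrArg Subtype.val h) (hS p p.2).ne
      · exact absurd (congrArg Subtype.val h).symm (hS q q.2).ne
      · rfl
    · rintro ⟨p, hp⟩
      rcases Finset.mem_insert.mp hp with rfl | hp
      · exact ⟨Sum.inr (), rfl⟩
      · exact ⟨Sum.inl ⟨p, hp⟩, rfl⟩)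
  have h1 := det_mem_minorsOfWeight (k := k) _ e (Sum.elim b fun _ : Unit => r)
  have h2 : (flagMatrix n k).submatrix (fun p => (e p : Fin n)) (Sum.elim b fun _ : Unit => r) =
      Matrix.fromBlocks ((flagMatrix n k).submatrix (fun p : S => (p : Fin n)) b) 0
        (Matrix.of fun _ q => flagMatrix n k r (b q)) (Matrix.of fun _ (_ : Unit) => flagMatrix n k r r) := by
    refine Matrix.ext fun p q => ?_
    rcases p with p | p <;> rcases q with q | q
    · rfl
    · exact flagMatrix_eq_zero k (hS p p.2)
    · rfl
    · rfl
  have h4 : (Matrix.of fun (_ : Unit) (_ : Unit) => flagMatrix n k r r).det =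
      flagMatrix n k r r := Matrix.det_unique _
  rw [h2, Matrix.det_fromBlocks_zero₁₂, h4, mul_comm] at h1
  have h3 : content (Sum.elim b fun _ : Unit => r) = content b + Finsupp.single r 1 := by
    simp [content, Fintype.sum_sum_type]
  rw [h3] at h1
  exact h1

theorem flagMatrix_mul_mem_minorSpan {m : ℕ} {D D' : Diagram n m} {r : Fin n} {c : Fin m}
    (hr : ∀ a ∈ D c, a < r) (hc : D' c = insert r (D c)) (hD : ∀ j, j ≠ c → D' j = D j)
    {α : Fin n →₀ ℕ} {x : FlagRing n k} (hx : x ∈ minorSpan k D α) :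
    flagMatrix n k r r * x ∈ minorSpan k D' (α + Finsupp.single r 1) := by
  have : minorSpan k D α ≤ (minorSpan k D' (α + Finsupp.single r 1)).comap
      (LinearMap.mulLeft k (flagMatrix n k r r)) := by
    refine Submodule.span_le.mpr ?_
    rintro _ ⟨g, β, hg, rfl, rfl⟩
    change flagMatrix n k r r * ∏ j, g j ∈ minorSpan k D' _
    have e1 : flagMatrix n k r r * ∏ j, g j =
        ∏ j, Function.update g c (flagMatrix n k r r * g c) j := by
      rw [← Finset.mul_prod_erase _ g (Finset.mem_univ c),
        ← Finset.mul_prod_erase _ _ (Finset.mem_univ c), Function.update_self, mul_assoc]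
      congr 2
      refine Finset.prod_congr rfl fun j hj => ?_
      rw [Function.update_of_ne (Finset.ne_of_mem_erase hj)]
    have e2 : ∑ j, Function.update β c (β c + Finsupp.single r 1) j =
        ∑ j, β j + Finsupp.single r 1 := by
      rw [← Finset.add_sum_erase _ β (Finset.mem_univ c),
        ← Finset.add_sum_erase _ _ (Finset.mem_univ c), Function.update_self, add_right_comm]
      congr 2
      refine Finset.sum_congr rfl fun j hj => ?_
      rw [Function.update_of_ne (Finset.ne_of_mem_erase hj)]
    rw [e1]
    refine prod_mem_minorSpan (fun j => ?_) e2
    rcases eq_or_ne j c with rfl | hj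
    · rw [Function.update_self, Function.update_self, hc]
      exact flagMatrix_mul_mem_minorsOfWeight hr (hg j)
    · rw [Function.update_of_ne hj, Function.update_of_ne hj, hD j hj]
      exact hg j
  exact this hx

end Box

/-! ### Rothe diagrams under transitions and row replacement -/

section Rothe

variable {n : ℕ}

theorem mem_rotheDiagram_apply {u : Equiv.Perm (Fin n)} {x y : Fin n} :
    x ∈ rotheDiagram u (u y) ↔ u y < u x ∧ x < y := by
  simp [rotheDiagram]

theorem mem_rotheDiagram_mul_swap_apply {u : Equiv.Perm (Fin n)} {a b x y : Fin n} :
    x ∈ rotheDiagram (u * Equiv.swap a b) (u y) ↔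
      (u y < if x = a then u b else if x = b then u a else u x) ∧
        x < if y = a then b else if y = b then a else y := by
  have h1 : (u * Equiv.swap a b) x = if x = a then u b else if x = b then u a else u x := by
    rw [Equiv.Perm.mul_apply, Equiv.swap_apply_def]
    split_ifs <;> rfl
  have h2 : (u * Equiv.swap a b)⁻¹ (u y) = if y = a then b else if y = b then a else y := by
    rw [mul_inv_rev, Equiv.swap_inv, Equiv.Perm.mul_apply,
      ← Equiv.Perm.mul_apply u⁻¹, inv_mul_cancel, Equiv.Perm.one_apply,
      Equiv.swap_apply_def]
  rw [← h1, ← h2]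
  simp only [rotheDiagram, Finset.mem_filter, Finset.mem_univ, true_and]

/-- The exchange adds a single box, at the bottom of this column, and by
`IsTransition.rotheDiagram_of_ne` changes no other column. This is why multiplication by z_rr embeds
one module into the other. -/
theorem IsTransition.rotheDiagram_self {u : Equiv.Perm (Fin n)} {r s : Fin n}
    (h : IsTransition u r s) :
    rotheDiagram (u * Equiv.swap r s) (u r) = insert r (rotheDiagram u (u r)) := by
  have h1 := h.lt
  have h2 := h.val_lt
  have h3 := h.val_gt
  ext x
  have h4 := h.inc x s
  rw [Finset.mem_insert, mem_rotheDiagram_mul_swap_apply, mem_rotheDiagram_apply]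
  have h5 := h3 x
  grind

theorem IsTransition.rotheDiagram_of_ne {u : Equiv.Perm (Fin n)} {r s : Fin n}
    (h : IsTransition u r s) {y : Fin n} (hy : y ≠ r) :
    rotheDiagram (u * Equiv.swap r s) (u y) = rotheDiagram u (u y) := by
  have h1 := h.lt
  have h2 := h.val_lt
  have h3 := h.val_gt
  ext x
  have h4 := h.inc x s
  have h6 := h.inc s y
  have h7 := h.inc x y
  have h8 := h.inc s x
  rw [mem_rotheDiagram_mul_swap_apply, mem_rotheDiagram_apply]
  have h5 := h3 x
  have h9 := h3 y
  have inj : u x = u y → x = y := fun e => u.injective e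
  have inj' : u r = u y → r = y := fun e => u.injective e
  have inj2 : u s = u y → s = y := fun e => u.injective e
  grind

/-- The Rothe diagram of `u (r s)` with the columns `u r` and `u i` replaced by their
intersection and their union. -/
def unionInterDiagram (u : Equiv.Perm (Fin n)) (r s i : Fin n) : Diagram n n :=
  Function.update (Function.update (rotheDiagram (u * Equiv.swap r s)) (u r)
    (rotheDiagram (u * Equiv.swap r s) (u r) ∩ rotheDiagram (u * Equiv.swap r s) (u i))) (u i)
    (rotheDiagram (u * Equiv.swap r s) (u r) ∪ rotheDiagram (u * Equiv.swap r s) (u i))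

variable {u : Equiv.Perm (Fin n)} {r s i : Fin n}

theorem unionInterDiagram_union :
    unionInterDiagram u r s i (u i) =
      rotheDiagram (u * Equiv.swap r s) (u r) ∪ rotheDiagram (u * Equiv.swap r s) (u i) :=
  Function.update_self _ _ _

theorem unionInterDiagram_inter (hir : i ≠ r) :
    unionInterDiagram u r s i (u r) =
      rotheDiagram (u * Equiv.swap r s) (u r) ∩ rotheDiagram (u * Equiv.swap r s) (u i) := by
  rw [unionInterDiagram, Function.update_of_ne (u.injective.ne hir.symm), Function.update_self]

theorem unionInterDiagram_of_ne {j : Fin n} (hi : j ≠ u i) (hr : j ≠ u r) :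
    unionInterDiagram u r s i j = rotheDiagram (u * Equiv.swap r s) j := by
  rw [unionInterDiagram, Function.update_of_ne hi, Function.update_of_ne hr]

theorem IsTransition.mem_self (h : IsTransition u r s) {x : Fin n} :
    x ∈ rotheDiagram (u * Equiv.swap r s) (u r) ↔ x = r ∨ u r < u x ∧ x < r := by
  rw [h.rotheDiagram_self, Finset.mem_insert, mem_rotheDiagram_apply]

theorem IsTransition.mem_of_ne (h : IsTransition u r s) {x y : Fin n} (hy : y ≠ r) :
    x ∈ rotheDiagram (u * Equiv.swap r s) (u y) ↔ u y < u x ∧ x < y := by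
  rw [h.rotheDiagram_of_ne hy, mem_rotheDiagram_apply]

theorem mem_replaceRow {S : Finset (Fin n)} {x : Fin n} :
    x ∈ replaceRow r i S ↔
      if r ∈ S ∧ i ∉ S then x = i ∨ x ≠ r ∧ x ∈ S else x ∈ S := by
  unfold replaceRow
  split_ifs <;> simp

/-- By the cover condition no position between i and r has a value between u(i) and u(r). Hence the
union, with r replaced by i, is column u(i) of the new diagram; the intersection lacks r and is
already column u(r). -/
theorem IsTransition.replaceRow_unionInterDiagram (h : IsTransition u r s)
    (hi : IsCover u i r) :
    (fun j => replaceRow r i (unionInterDiagram u r s i j)) =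
      rotheDiagram (u * Equiv.swap i r) := by
  obtain ⟨h1, h2, h3⟩ := hi
  funext j
  obtain ⟨y, rfl⟩ := u.surjective j
  ext x
  have h4 := h3 x
  have h5 := h3 y
  have inj1 : u x = u y → x = y := fun e => u.injective e
  have inj2 : u i = u y → i = y := fun e => u.injective e
  have inj3 : u r = u y → r = y := fun e => u.injective e
  have inj4 : u r = u x → r = x := fun e => u.injective e
  have inj5 : u i = u x → i = x := fun e => u.injective e
  rw [mem_replaceRow, mem_rotheDiagram_mul_swap_apply]
  rcases eq_or_ne y i with rfl | hyi
  · rw [unionInterDiagram_union]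
    simp only [Finset.mem_union, h.mem_self, h.mem_of_ne h1.ne]
    grind
  rcases eq_or_ne y r with rfl | hyr
  · rw [unionInterDiagram_inter h1.ne]
    simp only [Finset.mem_inter, h.mem_self, h.mem_of_ne h1.ne]
    grind
  · rw [unionInterDiagram_of_ne (u.injective.ne hyi) (u.injective.ne hyr)]
    simp only [h.mem_of_ne hyr]
    grind

/-- Exactly one of the two affected columns counts on either side: column u(r) contains r and not i,
as does the union, while column u(i) and the intersection lack r. -/
theorem IsTransition.sum_replaceDegree_unionInterDiagram (h : IsTransition u r s)
    (hi : IsCover u i r) :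
    ∑ j, replaceDegree r i (unionInterDiagram u r s i j) =
      ∑ j, replaceDegree r i (rotheDiagram (u * Equiv.swap r s) j) := by
  obtain ⟨h1, h2, h3⟩ := hi
  refine Fintype.sum_equiv (Equiv.swap (u i) (u r)) _ _ fun j => ?_
  unfold replaceDegree
  rcases eq_or_ne j (u i) with rfl | hji
  · rw [Equiv.swap_apply_left, unionInterDiagram_union]
    simp only [Finset.mem_union, h.mem_self, h.mem_of_ne h1.ne]
    grind
  rcases eq_or_ne j (u r) with rfl | hjr
  · rw [Equiv.swap_apply_right, unionInterDiagram_inter h1.ne]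
    simp only [Finset.mem_inter, h.mem_self, h.mem_of_ne h1.ne]
    grind
  · rw [Equiv.swap_apply_of_ne_of_ne hji hjr, unionInterDiagram_of_ne hji hjr]

/-- The cover condition for i' gives u(i) < u(i'), so i' lies in column u(i) and hence in the union.
Thus neither the union nor the intersection allows r to be replaced by i', whereas column u(r) did.
-/
theorem IsTransition.sum_replaceDegree_lt_of_lt (h : IsTransition u r s)
    (hi : IsCover u i r) {i' : Fin n} (hi' : IsCover u i' r) (hlt : i' < i) :
    ∑ j, replaceDegree r i' (unionInterDiagram u r s i j) <
      ∑ j, replaceDegree r i' (rotheDiagram (u * Equiv.swap r s) j) := by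
  have h1 := hi.1
  have h2 := hi.2.1
  have h1' := hi'.1
  have h2' := hi'.2.1
  have h3 := hi'.2.2 i hlt h1
  have inj : u i = u i' → i = i' := fun e => u.injective e
  refine Finset.sum_lt_sum (fun j _ => ?_) ⟨u r, Finset.mem_univ _, ?_⟩
  · unfold replaceDegree
    rcases eq_or_ne j (u i) with rfl | hji
    · rw [unionInterDiagram_union]
      simp only [Finset.mem_union, h.mem_self, h.mem_of_ne h1.ne]
      grind
    rcases eq_or_ne j (u r) with rfl | hjr
    · rw [unionInterDiagram_inter h1.ne]
      simp only [Finset.mem_inter, h.mem_self, h.mem_of_ne h1.ne]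
      grind
    · rw [unionInterDiagram_of_ne hji hjr]
  · unfold replaceDegree
    rw [unionInterDiagram_inter h1.ne]
    simp only [Finset.mem_inter, h.mem_self, h.mem_of_ne h1.ne]
    grind

/-- The added box in row r of column u(r) is one that can be moved to row i, because u(i) < u(r)
keeps i out of this column. -/
theorem IsTransition.sum_replaceDegree_rotheDiagram_lt (h : IsTransition u r s)
    (hi : IsCover u i r) :
    ∑ j, replaceDegree r i (rotheDiagram u j) <
      ∑ j, replaceDegree r i (rotheDiagram (u * Equiv.swap r s) j) := by
  have h1 := hi.1
  have h2 := hi.2.1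
  refine Finset.sum_lt_sum (fun j _ => ?_) ⟨u r, Finset.mem_univ _, ?_⟩
  · obtain ⟨y, rfl⟩ := u.surjective j
    unfold replaceDegree
    rcases eq_or_ne y r with rfl | hy
    · simp only [h.mem_self, mem_rotheDiagram_apply]
      grind
    · rw [h.rotheDiagram_of_ne hy]
  · unfold replaceDegree
    simp only [h.mem_self, mem_rotheDiagram_apply]
    grind

end Rothe

/-! ### Dimension count for the transition -/

section Inequality

/-- Add the indices in decreasing order. The part U built so far lies in the kernel of T_a, while
T_a maps B_a onto a space containing C_a, so rank-nullity on U + B_a adds dim C_a. -/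
theorem finrank_add_sum_finrank_le {k E F ι : Type*} [Field k] [AddCommGroup E] [Module k E]
    [AddCommGroup F] [Module k F] [LinearOrder ι] (s : Finset ι) (V K : Submodule k E)
    [FiniteDimensional k V] (B : ι → Submodule k E) (C : ι → Submodule k F) (T : ι → E →ₗ[k] F)
    (hK : K ≤ V) (hB : ∀ i ∈ s, B i ≤ V) (hKT : ∀ i ∈ s, K ≤ LinearMap.ker (T i))
    (hBT : ∀ i ∈ s, ∀ i' ∈ s, i' < i → B i ≤ LinearMap.ker (T i'))
    (hC : ∀ i ∈ s, C i ≤ (B i).map (T i)) :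
    Module.finrank k K + ∑ i ∈ s, Module.finrank k (C i) ≤ Module.finrank k V := by
  -- U plays the role of K plus the sum of the B_i; the induction needs only that every map killing
  -- all of these kills U.
  suffices H : ∃ U ≤ V, (∀ T' : E →ₗ[k] F, K ≤ LinearMap.ker T' →
      (∀ i ∈ s, B i ≤ LinearMap.ker T') → U ≤ LinearMap.ker T') ∧
      Module.finrank k K + ∑ i ∈ s, Module.finrank k (C i) ≤ Module.finrank k U by
    obtain ⟨U, hU, -, h⟩ := H
    exact h.trans (Submodule.finrank_mono hU)
  induction s using Finset.induction_on_min with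
  | empty => exact ⟨K, hK, fun T' h _ => h, by simp⟩
  | insert a s ha ih =>
    obtain ⟨U, hU, hUT, hle⟩ := ih (fun i hi => hB i (Finset.mem_insert_of_mem hi))
      (fun i hi => hKT i (Finset.mem_insert_of_mem hi))
      (fun i hi i' hi' => hBT i (Finset.mem_insert_of_mem hi) i' (Finset.mem_insert_of_mem hi'))
      (fun i hi => hC i (Finset.mem_insert_of_mem hi))
    have haa := Finset.mem_insert_self a s
    have hU' : U ⊔ B a ≤ V := sup_le hU (hB a haa)
    refine ⟨U ⊔ B a, hU', fun T' h1 h2 => sup_le (hUT T' h1 fun i hi =>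
      h2 i (Finset.mem_insert_of_mem hi)) (h2 a haa), ?_⟩
    have : FiniteDimensional k ↥(U ⊔ B a) := Submodule.finiteDimensional_of_le hU'
    have hUa : U ≤ LinearMap.ker (T a) := hUT (T a) (hKT a haa) fun i hi =>
      hBT i (Finset.mem_insert_of_mem hi) a haa (ha i hi)
    have h1 := LinearMap.finrank_range_add_finrank_ker ((T a).domRestrict (U ⊔ B a))
    have h2 : Module.finrank k (C a) ≤
        Module.finrank k (LinearMap.range ((T a).domRestrict (U ⊔ B a))) := by
      refine Submodule.finrank_mono ((hC a haa).trans ?_)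
      rintro _ ⟨x, hx, rfl⟩
      exact ⟨⟨x, Submodule.mem_sup_right hx⟩, rfl⟩
    have h3 : Module.finrank k U ≤
        Module.finrank k (LinearMap.ker ((T a).domRestrict (U ⊔ B a))) := by
      refine LinearMap.finrank_le_finrank_of_injective
        (f := LinearMap.codRestrict _ (Submodule.inclusion le_sup_left) fun x => ?_) ?_
      · exact hUa x.2
      · intro x y hxy
        exact Subtype.ext (congrArg (fun z => ((z : ↥(U ⊔ B a)) : E)) (congrArg Subtype.val hxy))
    rw [Finset.sum_insert fun h => (ha a h).false]
    omega

variable {n : ℕ} (k : Type*) [Field k]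

instance {m : ℕ} (D : Diagram n m) (α : Fin n →₀ ℕ) :
    FiniteDimensional k (minorSpan k D α) := by
  refine FiniteDimensional.span_of_finite k ((Set.finite_range
    fun τ : D.Filling => minorProduct k τ).subset ?_)
  rintro _ ⟨g, β, hg, -, rfl⟩
  choose τ _ hτ using hg
  exact ⟨τ, Finset.prod_congr rfl fun j _ => hτ j⟩

theorem flagMatrix_self_ne_zero (r : Fin n) : flagMatrix n k r r ≠ 0 := by
  have : flagMatrix n k r r = X ⟨(r, r), le_rfl⟩ := dif_pos le_rfl
  rw [this]
  exact X_ne_zero _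

/-- The dimensions of the weight spaces for the transition formula. -/
theorem IsTransition.sum_finrank_le {u : Equiv.Perm (Fin n)} {r s : Fin n}
    (h : IsTransition u r s) (α : Fin n →₀ ℕ) :
    (if r ∈ α.support then
        Module.finrank k (minorSpan k (rotheDiagram u) (α - Finsupp.single r 1)) else 0) +
      ∑ i ∈ coverPositions u r,
        Module.finrank k (minorSpan k (rotheDiagram (u * Equiv.swap i r)) α) ≤
      Module.finrank k (minorSpan k (rotheDiagram (u * Equiv.swap r s)) α) := by
  set K : Submodule k (FlagRing n k) := if r ∈ α.support then
    (minorSpan k (rotheDiagram u) (α - Finsupp.single r 1)).map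
      (LinearMap.mulLeft k (flagMatrix n k r r)) else ⊥ with hK
  have hKf : Module.finrank k K = if r ∈ α.support then
      Module.finrank k (minorSpan k (rotheDiagram u) (α - Finsupp.single r 1)) else 0 := by
    by_cases hr : r ∈ α.support
    · rw [hK, if_pos hr, if_pos hr]
      exact (Submodule.equivMapOfInjective _
        (mul_right_injective₀ (flagMatrix_self_ne_zero k r)) _).symm.finrank_eq
    · rw [hK, if_neg hr, if_neg hr]
      exact finrank_bot _ _
  rw [← hKf]
  -- Each T_i extracts the power of t that bounds the degree for D(u(r s)). For D(u), and for B_j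
  -- with j > i, the degree is strictly smaller; on B_i this power is the full degree bound.
  refine finrank_add_sum_finrank_le _ _ K
    (fun i => minorSpan k (unionInterDiagram u r s i) α) _
    (fun i => addRowCoeff k r i
      (∑ j, replaceDegree r i (rotheDiagram (u * Equiv.swap r s) j))) ?_ ?_ ?_ ?_ ?_
  · rw [hK]
    split_ifs with hr
    · rintro _ ⟨x, hx, rfl⟩
      have := flagMatrix_mul_mem_minorSpan (D' := rotheDiagram (u * Equiv.swap r s)) (c := u r)
        (r := r) (fun a ha => (mem_rotheDiagram_apply.mp ha).2) h.rotheDiagram_self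
        (fun j hj => ?_) hx
      · rwa [tsub_add_cancel_of_le] at this
        rw [Finsupp.single_le_iff]
        exact Nat.one_le_iff_ne_zero.mpr (Finsupp.mem_support_iff.mp hr)
      · obtain ⟨y, rfl⟩ := u.surjective j
        exact h.rotheDiagram_of_ne fun e => hj (by rw [e])
    · exact bot_le
  · intro i hi
    have hi := (mem_coverPositions.mp hi).1
    exact minorSpan_union_inter_le (u.injective.ne hi.ne) unionInterDiagram_union
      (unionInterDiagram_inter hi.ne) (fun j => unionInterDiagram_of_ne) α
  · intro i hi
    have hi := mem_coverPositions.mp hi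
    rw [hK]
    split_ifs
    · rintro _ ⟨x, hx, rfl⟩
      rw [LinearMap.mem_ker, LinearMap.mulLeft_apply, addRowCoeff_flagMatrix_mul hi.1,
        addRowCoeff_eq_zero hi.1 (h.sum_replaceDegree_rotheDiagram_lt hi) hx, mul_zero]
    · exact bot_le
  · intro i hi i' hi' hlt x hx
    have hi := mem_coverPositions.mp hi
    have hi' := mem_coverPositions.mp hi'
    exact addRowCoeff_eq_zero hi'.1 (h.sum_replaceDegree_lt_of_lt hi hi' hlt) hx
  · intro i hi
    have hi := mem_coverPositions.mp hi
    have := minorSpan_replaceRow_le (k := k) hi.1 (unionInterDiagram u r s i) α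
    rwa [h.replaceRow_unionInterDiagram hi, h.sum_replaceDegree_unionInterDiagram hi] at this

end Inequality

/-! ### Weight spaces -/

section Weights

variable {n : ℕ} {k : Type*} [CommRing k]

/-- The weight of the variable `z_{ij}`. -/
noncomputable def flagWeight (n : ℕ) (p : FlagIdx n) : Fin n →₀ ℕ :=
  Finsupp.single p.1.2 1

theorem torusAction_monomial (d : FlagIdx n →₀ ℕ) (c : k) :
    torusAction n k (monomial d c) = monomial d (monomial (Finsupp.weight (flagWeight n) d) c) := by
  rw [torusAction, aeval_monomial, monomial_eq (s := d)]
  simp only [Finsupp.prod, mul_pow, Finset.prod_mul_distrib]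
  rw [← mul_assoc]
  congr 1
  simp only [← map_pow, ← map_prod]
  rw [MvPolynomial.algebraMap_apply, ← map_mul, MvPolynomial.algebraMap_eq,
    Finsupp.weight_apply, monomial_finsupp_sum_index]
  congr 2
  refine Finset.prod_congr rfl fun p _ => ?_
  change _ = monomial (d p • Finsupp.single p.1.2 1) 1
  rw [Finsupp.smul_single, smul_eq_mul, mul_one, X_pow_eq_monomial]

theorem coeff_torusAction (d : FlagIdx n →₀ ℕ) (f : FlagRing n k) :
    coeff d (torusAction n k f) = monomial (Finsupp.weight (flagWeight n) d) (coeff d f) := by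
  induction f using MvPolynomial.induction_on' with
  | monomial d' c =>
    rw [torusAction_monomial, coeff_monomial, coeff_monomial]
    split_ifs with h
    · rw [h]
    · rw [map_zero]
  | add f g hf hg => rw [map_add, coeff_add, hf, hg, coeff_add, map_add]

/-- The generic torus element multiplies each coefficient by the monomial of its weight, so
comparing coefficients separates weights over any base. -/
theorem torusAction_eq_iff (α : Fin n →₀ ℕ) (f : FlagRing n k) :
    torusAction n k f = C (monomial α 1) * MvPolynomial.map C f ↔
      IsWeightedHomogeneous (flagWeight n) f α := by
  have key : ∀ d, coeff d (C (monomial α (1 : k)) * MvPolynomial.map C f) =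
      monomial α (coeff d f) := by
    intro d
    rw [coeff_C_mul, coeff_map, mul_comm, C_mul_monomial, mul_one]
  constructor
  · intro h d hd
    have := congrArg (coeff d) h
    rw [coeff_torusAction, key] at this
    exact (monomial_left_inj hd).mp this
  · intro h
    refine MvPolynomial.ext _ _ fun d => ?_
    rw [coeff_torusAction, key]
    by_cases hd : coeff d f = 0
    · rw [hd, map_zero, map_zero]
    · rw [h hd]

theorem isWeightedHomogeneous_flagMatrix (a b : Fin n) :
    IsWeightedHomogeneous (flagWeight n) (flagMatrix n k a b) (Finsupp.single b 1) := by
  by_cases h : b ≤ a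
  · have : flagMatrix n k a b = X ⟨(a, b), h⟩ := dif_pos h
    rw [this]
    exact isWeightedHomogeneous_X k (flagWeight n) ⟨(a, b), h⟩
  · rw [flagMatrix_eq_zero k (not_le.mp h)]
    exact isWeightedHomogeneous_zero k _ _

theorem isWeightedHomogeneous_of_mem_minorsOfWeight {S : Finset (Fin n)} {β : Fin n →₀ ℕ}
    {x : FlagRing n k} (hx : x ∈ minorsOfWeight k S β) :
    IsWeightedHomogeneous (flagWeight n) x β := by
  obtain ⟨b, rfl, rfl⟩ := hx
  rw [minor, Matrix.det_apply, ← mem_weightedHomogeneousSubmodule k]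
  refine sum_mem fun σ _ => ?_
  have : ∏ p, (flagMatrix n k).submatrix (fun p : S => (p : Fin n)) b (σ p) p ∈
      weightedHomogeneousSubmodule k (flagWeight n) (content b) := by
    rw [mem_weightedHomogeneousSubmodule]
    exact IsWeightedHomogeneous.prod _ _ _ fun p _ => isWeightedHomogeneous_flagMatrix _ _
  rcases Int.units_eq_one_or (Equiv.Perm.sign σ) with hs | hs
  · rwa [hs, one_smul]
  · rw [hs, Units.neg_smul, one_smul]
    exact neg_mem this

/-- A nonzero term gives a permutation σ of the rows with b(q) <= σ(q) for all q. If b(p) > p, then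
σ would inject the rows from p on into those strictly after p. -/
theorem le_of_minor_ne_zero {S : Finset (Fin n)} {b : S → Fin n} (hb : StrictMono b)
    (h : minor k S b ≠ 0) (p : S) : b p ≤ p := by
  rw [minor, Matrix.det_apply] at h
  obtain ⟨σ, -, hσ⟩ := Finset.exists_ne_zero_of_sum_ne_zero h
  have h1 : ∀ q, b q ≤ (σ q : S) := by
    intro q
    by_contra hq
    apply hσ
    rw [Finset.prod_eq_zero (Finset.mem_univ q), smul_zero]
    exact flagMatrix_eq_zero k (not_le.mp hq)
  by_contra hp
  have h2 : (Finset.Ici p).map σ.toEmbedding ⊆ (Finset.Ici p).erase p := by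
    intro q hq
    obtain ⟨q, hq', rfl⟩ := Finset.mem_map.mp hq
    have h3 : (p : Fin n) < (σ q : S) :=
      (not_le.mp hp).trans_le ((hb.monotone (Finset.mem_Ici.mp hq')).trans (h1 q))
    rw [Finset.mem_erase, Finset.mem_Ici]
    exact ⟨fun e => h3.ne (congrArg Subtype.val e).symm, h3.le⟩
  have h3 := Finset.card_le_card h2
  rw [Finset.card_map, Finset.card_erase_of_mem (Finset.mem_Ici.mpr le_rfl)] at h3
  have h4 : 0 < (Finset.Ici p).card := Finset.card_pos.mpr ⟨p, Finset.mem_Ici.mpr le_rfl⟩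
  omega

/-- Sorting distinct columns costs a sign, and a nonvanishing sorted minor is automatically flagged.
Arbitrary column choices in `minorSpan` therefore give nothing new. -/
theorem exists_minor_eq_smul (S : Finset (Fin n)) (b : S → Fin n) :
    minor k S b = 0 ∨ ∃ b' : S → Fin n, StrictMono b' ∧ (∀ p, b' p ≤ p) ∧
      ∃ c : k, minor k S b = c • minor k S b' := by
  by_cases h0 : minor k S b = 0
  · exact Or.inl h0
  have hinj : Function.Injective b := by
    intro p q hpq
    by_contra hne
    exact h0 (Matrix.det_zero_of_column_eq hne fun i => by simp [hpq])
  let e := S.orderIsoOfFin rfl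
  let σ : Equiv.Perm (Fin S.card) := Tuple.sort (b ∘ e)
  let π : Equiv.Perm S := e.symm.toEquiv.trans (σ.trans e.toEquiv)
  have hmono : StrictMono (b ∘ π) := by
    have h1 : Monotone ((b ∘ e) ∘ σ) := Tuple.monotone_sort _
    have h2 : StrictMono ((b ∘ e) ∘ σ) :=
      h1.strictMono_of_injective ((hinj.comp e.injective).comp σ.injective)
    exact h2.comp e.symm.strictMono
  have hdet : minor k S (b ∘ π) = Equiv.Perm.sign π * minor k S b := by
    rw [minor, minor, ← Matrix.det_permute' π]
    rfl
  have hdet' : minor k S b = ((Equiv.Perm.sign π : ℤ) : k) • minor k S (b ∘ π) := by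
    rw [hdet, smul_eq_C_mul]
    rcases Int.units_eq_one_or (Equiv.Perm.sign π) with hs | hs <;> simp [hs]
  refine Or.inr ⟨b ∘ π, hmono, le_of_minor_ne_zero (k := k) hmono fun h => h0 ?_, _, hdet'⟩
  rw [hdet', h, smul_zero]

theorem minorProduct_mem_flaggedSchurModule {m : ℕ} {D : Diagram n m} (τ : D.Filling) :
    minorProduct k τ ∈ flaggedSchurModule k D := by
  by_cases h : ∃ j, minor k (D j) (τ j) = 0
  · obtain ⟨j, hj⟩ := h
    have : minorProduct k τ = 0 := Finset.prod_eq_zero (Finset.mem_univ j) hj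
    rw [this]
    exact zero_mem _
  · push Not at h
    choose τ' h1 h2 c hc using fun j => (exists_minor_eq_smul (D j) (τ j)).resolve_left (h j)
    have : minorProduct k τ = (∏ j, c j) • minorProduct k (D := D) τ' := by
      rw [minorProduct, minorProduct, ← Finset.prod_smul]
      exact Finset.prod_congr rfl fun j _ => hc j
    rw [this]
    refine Submodule.smul_mem _ _ ⟨Finsupp.single ⟨τ', h1, h2⟩ 1, ?_⟩
    rw [exchangeMap, Finsupp.linearCombination_single, one_smul]

theorem minorProduct_mem_minorSpan {m : ℕ} {D : Diagram n m} (τ : D.Filling) :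
    minorProduct k τ ∈ minorSpan k D (∑ j, content (τ j)) :=
  prod_mem_minorSpan (g := fun j => minor k (D j) (τ j)) (fun j => ⟨τ j, rfl, rfl⟩) rfl

theorem isWeightedHomogeneous_of_mem_minorSpan {m : ℕ} {D : Diagram n m} {α : Fin n →₀ ℕ}
    {x : FlagRing n k} (hx : x ∈ minorSpan k D α) :
    IsWeightedHomogeneous (flagWeight n) x α := by
  have : minorSpan k D α ≤ weightedHomogeneousSubmodule k (flagWeight n) α := by
    refine Submodule.span_le.mpr ?_
    rintro _ ⟨g, β, hg, rfl, rfl⟩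
    exact IsWeightedHomogeneous.prod _ _ _ fun j _ =>
      isWeightedHomogeneous_of_mem_minorsOfWeight (hg j)
  exact this hx

/-- A weight vector equals its weighted homogeneous component, and taking components of homogeneous
generators keeps those of weight α and kills the others. -/
theorem flaggedWeightSpace_eq_minorSpan {m : ℕ} (D : Diagram n m) (α : Fin n →₀ ℕ) :
    flaggedWeightSpace k D α = minorSpan k D α := by
  classical
  refine le_antisymm ?_ ?_
  · rintro f ⟨⟨c, rfl⟩, hf⟩
    rw [torusAction_eq_iff] at hf
    rw [← hf.weightedHomogeneousComponent_same, exchangeMap, Finsupp.linearCombination_apply,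
      Finsupp.sum, map_sum]
    refine sum_mem fun τ _ => ?_
    rw [map_smul]
    refine Submodule.smul_mem _ _ ?_
    have hτ := minorProduct_mem_minorSpan (k := k) τ.1
    have hτ' := isWeightedHomogeneous_of_mem_minorSpan hτ
    by_cases h : ∑ j, content (τ.1 j) = α
    · rw [← h, hτ'.weightedHomogeneousComponent_same]
      exact hτ
    · rw [hτ'.weightedHomogeneousComponent_ne _ (Ne.symm h)]
      exact zero_mem _
  · intro f hf
    refine ⟨?_, (torusAction_eq_iff α f).mpr (isWeightedHomogeneous_of_mem_minorSpan hf)⟩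
    refine (Submodule.span_le (p := flaggedSchurModule k D)).mpr ?_ hf
    rintro _ ⟨g, β, hg, -, rfl⟩
    choose τ _ hτ using hg
    have : ∏ j, g j = minorProduct k (D := D) τ := Finset.prod_congr rfl fun j _ => (hτ j).symm
    rw [this]
    exact minorProduct_mem_flaggedSchurModule _

end Weights

/-! ### Coefficients of the character -/

section Character

variable {n m : ℕ} (k : Type*) [Field k]

theorem coeff_flaggedCharacter (D : Diagram n m) (α : Fin n →₀ ℕ) :
    coeff α (flaggedCharacter k D) = (Module.finrank k (minorSpan k D α) : ℤ) := by
  classical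
  -- A `finsum` with infinite support is zero by default; the finitely many contents of fillings
  -- contain the support.
  set s : Set (Fin n →₀ ℕ) := Set.range fun τ : D.Filling => ∑ j, content (τ j) with hs
  have hsf : s.Finite := Set.finite_range _
  have h0 : ∀ α, α ∉ s → Module.finrank k (minorSpan k D α) = 0 := by
    intro α hα
    have : minorSpan k D α = ⊥ := by
      refine Submodule.span_eq_bot.mpr ?_
      rintro _ ⟨g, β, hg, rfl, rfl⟩
      choose τ hτ _ using hg
      exact absurd ⟨τ, Finset.sum_congr rfl fun j _ => hτ j⟩ hα
    rw [this, finrank_bot]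
  have hfin : ∀ α, Module.finrank k (flaggedWeightSpace k D α) =
      Module.finrank k (minorSpan k D α) := fun α => by rw [flaggedWeightSpace_eq_minorSpan]
  rw [flaggedCharacter, finsum_eq_sum_of_support_subset (s := hsf.toFinset), coeff_sum]
  · simp only [coeff_monomial, hfin]
    rw [Finset.sum_ite_eq']
    split_ifs with h
    · rfl
    · rw [h0 α (by simpa using h), Nat.cast_zero]
  · intro α hα
    rw [Set.Finite.coe_toFinset]
    by_contra h
    refine hα ?_
    simp only [hfin]
    rw [h0 α h, Nat.cast_zero, map_zero]

end Character

/-! ### Stability of the characters -/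

section CharacterStability

variable {n : ℕ}

section

variable (k : Type*) [CommRing k]

/-- The inclusion of the indices of the variables for `n` into those for `n + 1`. -/
def castFlagIdx (n : ℕ) (p : FlagIdx n) : FlagIdx (n + 1) :=
  ⟨(p.1.1.castSucc, p.1.2.castSucc), Fin.castSucc_le_castSucc_iff.mpr p.2⟩

theorem castFlagIdx_injective (n : ℕ) : Function.Injective (castFlagIdx n) := by
  rintro ⟨⟨a, b⟩, h⟩ ⟨⟨a', b'⟩, h'⟩ e
  have := congrArg Subtype.val e
  simpa [castFlagIdx] using this

theorem rename_flagMatrix (a b : Fin n) :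
    rename (castFlagIdx n) (flagMatrix n k a b) =
      flagMatrix (n + 1) k a.castSucc b.castSucc := by
  by_cases h : b ≤ a
  · have h1 : flagMatrix n k a b = X ⟨(a, b), h⟩ := dif_pos h
    have h2 : flagMatrix (n + 1) k a.castSucc b.castSucc = X (castFlagIdx n ⟨(a, b), h⟩) :=
      dif_pos (Fin.castSucc_le_castSucc_iff.mpr h)
    rw [h1, h2, rename_X]
  · rw [flagMatrix_eq_zero k (not_le.mp h), flagMatrix_eq_zero k
      (Fin.castSucc_lt_castSucc_iff.mpr (not_le.mp h)), map_zero]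

variable {k}

theorem mapDomain_content {ι : Type*} [Fintype ι] (b : ι → Fin n) :
    Finsupp.mapDomain Fin.castSucc (content b) = content fun p => (b p).castSucc := by
  rw [content, content, Finsupp.mapDomain_finsetSum]
  simp only [Finsupp.mapDomain_single]

theorem rename_mem_minorsOfWeight {S : Finset (Fin n)} {β : Fin n →₀ ℕ} {x : FlagRing n k}
    (hx : x ∈ minorsOfWeight k S β) :
    rename (castFlagIdx n) x ∈
      minorsOfWeight k (S.map Fin.castSuccEmb) (Finsupp.mapDomain Fin.castSucc β) := by
  obtain ⟨b, rfl, rfl⟩ := hx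
  rw [mapDomain_content]
  convert det_mem_minorsOfWeight (k := k) _ (Finset.equivMap Fin.castSuccEmb S)
    (fun p => (b p).castSucc) using 1
  rw [minor, AlgHom.map_det]
  congr 1
  refine Matrix.ext fun p q => ?_
  exact rename_flagMatrix k p (b q)

/-- The last column of the generic matrix vanishes above the last row, so a nonzero minor on the old
rows uses old columns only. -/
theorem exists_of_mem_minorsOfWeight_map {S : Finset (Fin n)} {β' : Fin (n + 1) →₀ ℕ}
    {x : FlagRing (n + 1) k} (hx : x ∈ minorsOfWeight k (S.map Fin.castSuccEmb) β') :
    x = 0 ∨ ∃ β, ∃ y ∈ minorsOfWeight k S β,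
      β' = Finsupp.mapDomain Fin.castSucc β ∧ rename (castFlagIdx n) y = x := by
  obtain ⟨b, rfl, rfl⟩ := hx
  by_cases h : ∃ p, b p = Fin.last n
  · obtain ⟨p, hp⟩ := h
    refine Or.inl (Matrix.det_eq_zero_of_column_eq_zero p fun q => ?_)
    obtain ⟨q, hq⟩ := q
    obtain ⟨q, -, rfl⟩ := Finset.mem_map.mp hq
    rw [Matrix.submatrix_apply, hp]
    exact flagMatrix_eq_zero k (Fin.castSucc_lt_last q)
  · push Not at h
    choose c hc using fun p => Fin.exists_castSucc_eq.mpr (h p)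
    let e := Finset.equivMap Fin.castSuccEmb S
    refine Or.inr ⟨content (c ∘ e), minor k S (c ∘ e), ⟨_, rfl, rfl⟩, ?_, ?_⟩
    · rw [content_comp_equiv, mapDomain_content]
      congr 1
      exact funext fun p => (hc p).symm
    · rw [minor, minor, AlgHom.map_det, ← Matrix.det_submatrix_equiv_self e]
      congr 1
      refine Matrix.ext fun p q => ?_
      refine (rename_flagMatrix k p (c (e q))).trans ?_
      rw [hc]
      rfl

theorem mem_minorsOfWeight_empty {β : Fin n →₀ ℕ} {x : FlagRing n k} :
    x ∈ minorsOfWeight k ∅ β ↔ β = 0 ∧ x = 1 := by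
  constructor
  · rintro ⟨b, rfl, rfl⟩
    exact ⟨Finset.sum_of_isEmpty _, Matrix.det_isEmpty⟩
  · rintro ⟨rfl, rfl⟩
    exact ⟨fun p => absurd p.2 (Finset.notMem_empty _), Finset.sum_of_isEmpty _,
      Matrix.det_isEmpty⟩

theorem rotheDiagram_extendPerm_castSucc (w : Equiv.Perm (Fin n)) (j : Fin n) :
    rotheDiagram (extendPerm w) j.castSucc = (rotheDiagram w j).map Fin.castSuccEmb := by
  ext x
  simp only [rotheDiagram, ← extendPerm_inv, extendPerm_castSucc, Finset.mem_filter,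
    Finset.mem_univ, true_and, Finset.mem_map, Fin.coe_castSuccEmb]
  constructor
  · rintro ⟨h1, h2⟩
    obtain ⟨x, rfl⟩ := Fin.exists_castSucc_eq.mpr (h2.trans (Fin.castSucc_lt_last _)).ne
    rw [extendPerm_castSucc] at h1
    exact ⟨x, ⟨Fin.castSucc_lt_castSucc_iff.mp h1, Fin.castSucc_lt_castSucc_iff.mp h2⟩, rfl⟩
  · rintro ⟨x, ⟨h1, h2⟩, rfl⟩
    rw [extendPerm_castSucc]
    exact ⟨Fin.castSucc_lt_castSucc_iff.mpr h1, Fin.castSucc_lt_castSucc_iff.mpr h2⟩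

theorem rotheDiagram_extendPerm_last (w : Equiv.Perm (Fin n)) :
    rotheDiagram (extendPerm w) (Fin.last n) = ∅ := by
  ext x
  simp only [rotheDiagram, Finset.mem_filter, Finset.mem_univ, true_and, Finset.notMem_empty,
    iff_false]
  exact fun h => absurd h.1 (Fin.le_last _).not_gt

theorem rename_mem_minorSpan {D : Diagram n n} {D' : Diagram (n + 1) (n + 1)}
    (hD : ∀ j : Fin n, D' j.castSucc = (D j).map Fin.castSuccEmb) (hl : D' (Fin.last n) = ∅)
    {α : Fin n →₀ ℕ} {x : FlagRing n k} (hx : x ∈ minorSpan k D α) :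
    rename (castFlagIdx n) x ∈ minorSpan k D' (Finsupp.mapDomain Fin.castSucc α) := by
  have : minorSpan k D α ≤ (minorSpan k D' (Finsupp.mapDomain Fin.castSucc α)).comap
      (rename (R := k) (castFlagIdx n)).toLinearMap := by
    refine Submodule.span_le.mpr ?_
    rintro _ ⟨g, β, hg, rfl, rfl⟩
    change rename (castFlagIdx n) (∏ j, g j) ∈ minorSpan k D' _
    have h1 : rename (castFlagIdx n) (∏ j, g j) =
        ∏ j, Fin.snoc (α := fun _ => FlagRing (n + 1) k)
          (fun j => rename (castFlagIdx n) (g j)) 1 j := by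
      rw [Fin.prod_univ_castSucc, Fin.snoc_last, mul_one, map_prod]
      simp only [Fin.snoc_castSucc]
    have h2 : ∑ j, Fin.snoc (α := fun _ => Fin (n + 1) →₀ ℕ)
          (fun j => Finsupp.mapDomain Fin.castSucc (β j)) 0 j =
        Finsupp.mapDomain Fin.castSucc (∑ j, β j) := by
      rw [Fin.sum_univ_castSucc, Fin.snoc_last, add_zero, Finsupp.mapDomain_finsetSum]
      simp only [Fin.snoc_castSucc]
    rw [h1]
    refine prod_mem_minorSpan (fun j => ?_) h2
    refine Fin.lastCases ?_ (fun j => ?_) j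
    · rw [Fin.snoc_last, Fin.snoc_last, hl]
      exact mem_minorsOfWeight_empty.mpr ⟨rfl, rfl⟩
    · rw [Fin.snoc_castSucc, Fin.snoc_castSucc, hD]
      exact rename_mem_minorsOfWeight (hg j)
  exact this hx

/-- The target `W` is arbitrary so as to serve both for the image of the smaller span and for the
zero space, when the weight does not come from n variables. -/
theorem mem_of_mem_minorSpan_extend {D : Diagram n n} {D' : Diagram (n + 1) (n + 1)}
    (hD : ∀ j : Fin n, D' j.castSucc = (D j).map Fin.castSuccEmb) (hl : D' (Fin.last n) = ∅)
    {α' : Fin (n + 1) →₀ ℕ} {W : Submodule k (FlagRing (n + 1) k)}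
    (hW : ∀ α, α' = Finsupp.mapDomain Fin.castSucc α → ∀ y ∈ minorSpan k D α,
      rename (castFlagIdx n) y ∈ W) : minorSpan k D' α' ≤ W := by
  refine Submodule.span_le.mpr ?_
  rintro _ ⟨g, β, hg, rfl, rfl⟩
  have hgl := hg (Fin.last n)
  rw [hl, mem_minorsOfWeight_empty] at hgl
  rw [Fin.prod_univ_castSucc, hgl.2, mul_one, SetLike.mem_coe]
  by_cases h0 : ∃ j : Fin n, g j.castSucc = 0
  · obtain ⟨j, hj⟩ := h0
    rw [Finset.prod_eq_zero (Finset.mem_univ j) hj]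
    exact zero_mem W
  · push Not at h0
    choose γ y hy hγ hyg using fun j : Fin n =>
      (exists_of_mem_minorsOfWeight_map (hD j ▸ hg j.castSucc)).resolve_left (h0 j)
    have := hW (∑ j, γ j) (by
      rw [Fin.sum_univ_castSucc, hgl.1, add_zero, Finsupp.mapDomain_finsetSum]
      exact Finset.sum_congr rfl fun j _ => hγ j) _ (prod_mem_minorSpan hy rfl)
    rw [map_prod] at this
    simpa only [hyg] using this

end

variable (k : Type*) [Field k]

theorem flaggedCharacter_extendPerm (w : Equiv.Perm (Fin n)) :
    flaggedCharacter k (rotheDiagram (extendPerm w)) =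
      rename Fin.castSucc (flaggedCharacter k (rotheDiagram w)) := by
  have hD := rotheDiagram_extendPerm_castSucc w
  have hl := rotheDiagram_extendPerm_last w
  have hinj := Finsupp.mapDomain_injective (M := ℕ) (Fin.castSucc_injective n)
  refine MvPolynomial.ext _ _ fun α' => ?_
  rw [coeff_flaggedCharacter]
  by_cases h : ∃ α, Finsupp.mapDomain Fin.castSucc α = α'
  · obtain ⟨α, rfl⟩ := h
    rw [coeff_rename_mapDomain _ (Fin.castSucc_injective n), coeff_flaggedCharacter]
    have : minorSpan k (rotheDiagram (extendPerm w)) (Finsupp.mapDomain Fin.castSucc α) =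
        (minorSpan k (rotheDiagram w) α).map (rename (R := k) (castFlagIdx n)).toLinearMap := by
      refine le_antisymm (mem_of_mem_minorSpan_extend hD hl fun γ hγ y hy => ?_) ?_
      · rw [hinj hγ]
        exact ⟨y, hy, rfl⟩
      · rintro _ ⟨y, hy, rfl⟩
        exact rename_mem_minorSpan hD hl hy
    rw [this]
    congr 1
    exact (Submodule.equivMapOfInjective _
      (rename_injective _ (castFlagIdx_injective n)) _).symm.finrank_eq
  · rw [coeff_rename_eq_zero _ _ _ fun u hu => absurd ⟨u, hu⟩ h]
    have : minorSpan k (rotheDiagram (extendPerm w)) α' ≤ ⊥ :=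
      mem_of_mem_minorSpan_extend hD hl fun γ hγ => absurd ⟨γ, hγ.symm⟩ h
    rw [le_bot_iff.mp this, finrank_bot, Nat.cast_zero]

end CharacterStability

/-! ### The upper bound -/

section UpperBound

variable {n : ℕ}

/-- A column with one box in row r contributes a single entry z_rq, which is nonzero only for q <=
r. -/
theorem minorSpan_singleton_le {k : Type*} [CommRing k] {m : ℕ} {D D' : Diagram n m} {r : Fin n}
    {c : Fin m} (hc : D c = ∅) (hc' : D' c = {r}) (hD : ∀ j, j ≠ c → D' j = D j)
    (s : Finset (Fin n)) (hs : ∀ q, q ≤ r → q ∈ s) (α : Fin n →₀ ℕ) :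
    minorSpan k D' α ≤ s.sup fun q => if q ∈ α.support then
      (minorSpan k D (α - Finsupp.single q 1)).map (LinearMap.mulLeft k (flagMatrix n k r q))
      else ⊥ := by
  refine Submodule.span_le.mpr ?_
  rintro _ ⟨g, β, hg, rfl, rfl⟩
  have hgc := hg c
  rw [hc'] at hgc
  obtain ⟨b, hb1, hb2⟩ := hgc
  set q := b ⟨r, Finset.mem_singleton_self r⟩ with hq
  have hu : ∀ p : ↥({r} : Finset (Fin n)), p = ⟨r, Finset.mem_singleton_self r⟩ := fun p =>
    Subtype.ext (Finset.mem_singleton.mp p.2)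
  have hβ : β c = Finsupp.single q 1 := by
    rw [← hb1, content, Finset.sum_eq_single_of_mem _ (Finset.mem_univ _)
      fun p _ hp => absurd (hu p) hp]
  have hgq : g c = flagMatrix n k r q := by
    have : Unique ↥({r} : Finset (Fin n)) := ⟨⟨⟨r, Finset.mem_singleton_self r⟩⟩, hu⟩
    rw [← hb2, minor, Matrix.det_eq_elem_of_subsingleton _ ⟨r, Finset.mem_singleton_self r⟩]
    rfl
  have h1 : ∏ j, g j = flagMatrix n k r q * ∏ j, Function.update g c 1 j := by
    rw [← Finset.mul_prod_erase _ g (Finset.mem_univ c),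
      ← Finset.mul_prod_erase _ _ (Finset.mem_univ c), Function.update_self, one_mul, hgq]
    congr 1
    refine Finset.prod_congr rfl fun j hj => ?_
    rw [Function.update_of_ne (Finset.ne_of_mem_erase hj)]
  have h2 : ∑ j, β j = ∑ j, Function.update β c 0 j + Finsupp.single q 1 := by
    rw [← Finset.add_sum_erase _ β (Finset.mem_univ c),
      ← Finset.add_sum_erase _ (Function.update β c 0) (Finset.mem_univ c),
      Function.update_self, zero_add, hβ, add_comm]
    congr 1
    refine Finset.sum_congr rfl fun j hj => ?_
    rw [Function.update_of_ne (Finset.ne_of_mem_erase hj)]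
  rw [SetLike.mem_coe, h1]
  by_cases hqr : q ≤ r
  · refine Finset.le_sup (f := fun q => if q ∈ (∑ j, β j).support then
      (minorSpan k D (∑ j, β j - Finsupp.single q 1)).map
        (LinearMap.mulLeft k (flagMatrix n k r q)) else ⊥) (hs q hqr) ?_
    rw [if_pos (by rw [h2]; simp), h2, add_tsub_cancel_right]
    refine ⟨_, prod_mem_minorSpan (fun j => ?_) rfl, rfl⟩
    rcases eq_or_ne j c with rfl | hj
    · rw [Function.update_self, Function.update_self, hc]
      exact mem_minorsOfWeight_empty.mpr ⟨rfl, rfl⟩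
    · rw [Function.update_of_ne hj, Function.update_of_ne hj, ← hD j hj]
      exact hg j
  · rw [flagMatrix_eq_zero k (not_le.mp hqr), zero_mul]
    exact zero_mem _

variable (k : Type*) [Field k]

theorem finrank_finset_sup_le {E ι : Type*} [AddCommGroup E] [Module k E] (s : Finset ι)
    (V : ι → Submodule k E) [∀ i, FiniteDimensional k (V i)] :
    Module.finrank k ↥(s.sup V) ≤ ∑ i ∈ s, Module.finrank k (V i) := by
  classical
  induction s using Finset.induction_on with
  | empty => simp
  | insert a s ha ih =>
    rw [Finset.sup_insert, Finset.sum_insert ha]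
    exact (Submodule.finrank_add_le_finrank_add_finrank _ _).trans (by gcongr)

theorem finrank_minorSpan_singleton_le {m : ℕ} {D D' : Diagram n m} {r : Fin n}
    {c : Fin m} (hc : D c = ∅) (hc' : D' c = {r}) (hD : ∀ j, j ≠ c → D' j = D j)
    (s : Finset (Fin n)) (hs : ∀ q, q ≤ r → q ∈ s) (α : Fin n →₀ ℕ) :
    Module.finrank k (minorSpan k D' α) ≤ ∑ q ∈ s, if q ∈ α.support then
      Module.finrank k (minorSpan k D (α - Finsupp.single q 1)) else 0 := by
  have hfd : ∀ q, FiniteDimensional k ↥(if q ∈ α.support then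
      (minorSpan k D (α - Finsupp.single q 1)).map (LinearMap.mulLeft k (flagMatrix n k r q))
      else ⊥) := by
    intro q
    by_cases hq : q ∈ α.support
    · rw [if_pos hq]
      infer_instance
    · rw [if_neg hq]
      infer_instance
  refine (Submodule.finrank_mono (minorSpan_singleton_le hc hc' hD s hs α)).trans
    ((finrank_finset_sup_le k _ _).trans (Finset.sum_le_sum fun q _ => ?_))
  by_cases hq : q ∈ α.support
  · rw [if_pos hq, if_pos hq]
    exact Submodule.finrank_map_le _ _
  · rw [if_neg hq, if_neg hq, finrank_bot]

end UpperBound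

/-! ### The theorem of Kraśkiewicz and Pragacz -/

section Main

variable {n : ℕ} (k : Type*) [Field k]

theorem flaggedCharacter_rotheDiagram_one :
    flaggedCharacter k (rotheDiagram (1 : Equiv.Perm (Fin n))) = 1 := by
  have hD : ∀ j, rotheDiagram (1 : Equiv.Perm (Fin n)) j = ∅ := by
    intro j
    ext x
    simp only [rotheDiagram, Finset.mem_filter, Finset.mem_univ, true_and, Finset.notMem_empty,
      iff_false, inv_one, Equiv.Perm.one_apply]
    exact fun h => h.1.asymm h.2
  refine MvPolynomial.ext _ _ fun α => ?_
  rw [coeff_flaggedCharacter, coeff_one]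
  have hset : ∀ x, (∃ (g : Fin n → FlagRing n k) (β : Fin n → Fin n →₀ ℕ),
      (∀ j, g j ∈ minorsOfWeight k (rotheDiagram (1 : Equiv.Perm (Fin n)) j) (β j)) ∧
        ∑ j, β j = α ∧ ∏ j, g j = x) ↔ 0 = α ∧ 1 = x := by
    intro x
    simp only [hD, mem_minorsOfWeight_empty]
    constructor
    · rintro ⟨g, β, h, rfl, rfl⟩
      simp [h]
    · rintro ⟨rfl, rfl⟩
      exact ⟨fun _ => 1, fun _ => 0, by simp, by simp, by simp⟩
  have hspan : minorSpan k (rotheDiagram (1 : Equiv.Perm (Fin n))) α =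
      Submodule.span k {x | 0 = α ∧ 1 = x} :=
    congrArg (Submodule.span k) (Set.ext hset)
  rw [hspan]
  split_ifs with h
  · have : {x : FlagRing n k | 0 = α ∧ 1 = x} = {1} := by
      ext x
      simp [h, eq_comm]
    rw [this, finrank_span_singleton one_ne_zero, Nat.cast_one]
  · have : {x : FlagRing n k | 0 = α ∧ 1 = x} = ∅ :=
      Set.eq_empty_of_forall_notMem fun x hx => h hx.1
    rw [this, Submodule.span_empty, finrank_bot, Nat.cast_zero]

variable {k}

theorem IsTransition.coeff_flaggedCharacter_le {u : Equiv.Perm (Fin n)} {r s : Fin n}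
    (h : IsTransition u r s) (α : Fin n →₀ ℕ) :
    coeff α (X r * flaggedCharacter k (rotheDiagram u)) +
        ∑ i ∈ coverPositions u r, coeff α (flaggedCharacter k (rotheDiagram (u * Equiv.swap i r)))
      ≤ coeff α (flaggedCharacter k (rotheDiagram (u * Equiv.swap r s))) := by
  have := h.sum_finrank_le k α
  rw [mul_comm, coeff_mul_X']
  simp only [coeff_flaggedCharacter]
  split_ifs at this ⊢ <;> exact_mod_cast this

theorem coeff_X_mul_le {σ : Type*} {f g : MvPolynomial σ ℤ} (h : ∀ α, coeff α f ≤ coeff α g)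
    (r : σ) (α : σ →₀ ℕ) : coeff α (X r * f) ≤ coeff α (X r * g) := by
  classical
  rw [mul_comm, coeff_mul_X', mul_comm, coeff_mul_X']
  split_ifs
  · exact h _
  · exact le_rfl

theorem IsTransition.coeff_schubertPolynomial {u : Equiv.Perm (Fin n)} {r s : Fin n}
    (h : IsTransition u r s) (α : Fin n →₀ ℕ) :
    coeff α (schubertPolynomial (u * Equiv.swap r s)) = coeff α (X r * schubertPolynomial u) +
      ∑ i ∈ coverPositions u r, coeff α (schubertPolynomial (u * Equiv.swap i r)) := by
  rw [h.schubertPolynomial_eq, coeff_add, coeff_sum]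

variable (k) in
-- Induction along transitions: the same recursion is an equality for the polynomials and an
-- inequality for the characters.
theorem coeff_schubertPolynomial_le (w : Equiv.Perm (Fin n)) (α : Fin n →₀ ℕ) :
    coeff α (schubertPolynomial w) ≤ coeff α (flaggedCharacter k (rotheDiagram w)) := by
  induction w using transition_induction generalizing α with
  | one => rw [schubertPolynomial_one, flaggedCharacter_rotheDiagram_one]
  | step u r s h hu hi =>
    rw [h.coeff_schubertPolynomial]
    exact (add_le_add (coeff_X_mul_le hu r α) (Finset.sum_le_sum fun i hir =>
      hi i (mem_coverPositions.mp hir) α)).trans (h.coeff_flaggedCharacter_le α)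

/-- If the character is the Schubert polynomial for the permutation on the left hand side of the
transition formula, then also for those on the right hand side. -/
theorem IsTransition.flaggedCharacter_eq {u : Equiv.Perm (Fin n)} {r s i : Fin n}
    (h : IsTransition u r s) (hi : IsCover u i r)
    (he : flaggedCharacter k (rotheDiagram (u * Equiv.swap r s)) =
      schubertPolynomial (u * Equiv.swap r s)) :
    flaggedCharacter k (rotheDiagram (u * Equiv.swap i r)) =
      schubertPolynomial (u * Equiv.swap i r) := by
  refine MvPolynomial.ext _ _ fun α => (eq_of_le_of_not_lt
    (coeff_schubertPolynomial_le k _ α) fun hlt => ?_).symm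
  have h1 := h.coeff_flaggedCharacter_le (k := k) α
  rw [he, h.coeff_schubertPolynomial] at h1
  -- The lower bound holds for every term of the transition, so a strict inequality at i would make
  -- the right-hand side exceed the left.
  have h2 := Finset.sum_lt_sum (fun j _ => coeff_schubertPolynomial_le k (u * Equiv.swap j r) α)
    ⟨i, mem_coverPositions.mpr hi, hlt⟩
  have h3 := coeff_X_mul_le (coeff_schubertPolynomial_le k u) r α
  exact absurd h1 (not_le.mpr (add_lt_add_of_le_of_lt h3 h2))

/-- Column n of the diagram is empty before the exchange and has one box, in row n, after it. This
bounds the character by (x_0 + ... + x_n) times the old one, which Monk's formula identifies with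
the Schubert polynomial, the known lower bound. -/
theorem flaggedCharacter_extendPerm_mul_swap (u : Equiv.Perm (Fin n))
    (he : flaggedCharacter k (rotheDiagram (extendPerm (extendPerm u))) =
      schubertPolynomial (extendPerm (extendPerm u))) :
    flaggedCharacter k (rotheDiagram (extendPerm (extendPerm u) *
        Equiv.swap (Fin.last n).castSucc (Fin.last (n + 1)))) =
      schubertPolynomial (extendPerm (extendPerm u) *
        Equiv.swap (Fin.last n).castSucc (Fin.last (n + 1))) := by
  set v := extendPerm (extendPerm u) with hv
  set r : Fin (n + 2) := (Fin.last n).castSucc with hr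
  have hvr : v r = r := by rw [hv, hr, extendPerm_castSucc, extendPerm_last]
  have hvl : v (Fin.last (n + 1)) = Fin.last (n + 1) := extendPerm_last _
  have hlt : r < Fin.last (n + 1) := Fin.castSucc_lt_last _
  have hrn : (r : ℕ) = n := rfl
  have ht : IsTransition v r (Fin.last (n + 1)) := by
    refine ⟨hlt, fun a b ha hab => ?_, by rwa [hvr, hvl], fun a ha hal => ?_⟩
    · have := b.2
      omega
    · rw [Fin.lt_def, Fin.val_last] at hal
      omega
  have hc : rotheDiagram v r = ∅ := by
    ext x
    simp only [Finset.notMem_empty, iff_false]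
    nth_rewrite 1 [← hvr]
    rw [mem_rotheDiagram_apply, hvr]
    rintro ⟨h1, h2⟩
    have h3 : v x = Fin.last (n + 1) := Fin.ext (by rw [Fin.val_last]; omega)
    rw [← hvl] at h3
    have h4 := v.injective h3
    rw [h4] at h2
    exact h2.asymm hlt
  have hc' := ht.rotheDiagram_self
  rw [hvr, hc, insert_empty_eq] at hc'
  have hD : ∀ j, j ≠ r → rotheDiagram (v * Equiv.swap r (Fin.last (n + 1))) j =
      rotheDiagram v j := by
    intro j hj
    obtain ⟨y, rfl⟩ := v.surjective j
    exact ht.rotheDiagram_of_ne fun e => hj (by rw [e, hvr])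
  refine MvPolynomial.ext _ _ fun α => le_antisymm ?_ (coeff_schubertPolynomial_le k _ α)
  rw [schubertPolynomial_extendPerm_mul_swap, ← hv, ← he, coeff_sum]
  have := finrank_minorSpan_singleton_le k hc hc' hD (Finset.univ.map Fin.castSuccEmb)
    (fun q hq => ?_) α
  · rw [Finset.sum_map] at this
    rw [coeff_flaggedCharacter]
    refine (Nat.cast_le.mpr this).trans (le_of_eq ?_)
    rw [Nat.cast_sum]
    refine Finset.sum_congr rfl fun q _ => ?_
    rw [mul_comm, coeff_mul_X', coeff_flaggedCharacter]
    by_cases hq : Fin.castSuccEmb q ∈ α.support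
    · rw [if_pos hq, if_pos (show q.castSucc ∈ α.support from hq)]
      rfl
    · rw [if_neg hq, if_neg (show q.castSucc ∉ α.support from hq), Nat.cast_zero]
  · obtain ⟨q, rfl⟩ := Fin.exists_castSucc_eq.mpr (hq.trans_lt hlt).ne
    exact Finset.mem_map_of_mem _ (Finset.mem_univ q)

theorem extendPerm_extendPerm_apply_of_le (w : Equiv.Perm (Fin n)) (y : Fin (n + 2))
    (hy : n ≤ y) : extendPerm (extendPerm w) y = y := by
  refine Fin.lastCases (motive := fun y => n ≤ (y : ℕ) → extendPerm (extendPerm w) y = y)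
    (fun _ => extendPerm_last _) (fun y => ?_) y hy
  refine Fin.lastCases (motive := fun y => n ≤ (y.castSucc : ℕ) →
    extendPerm (extendPerm w) y.castSucc = y.castSucc) (fun _ => ?_) (fun y hy => ?_) y
  · rw [extendPerm_castSucc, extendPerm_last]
  · exact absurd y.2 (not_lt.mpr hy)

theorem flaggedCharacter_extendPerm_extendPerm (w : Equiv.Perm (Fin n)) :
    flaggedCharacter k (rotheDiagram (extendPerm (extendPerm w))) =
      schubertPolynomial (extendPerm (extendPerm w)) := by
  suffices H : ∀ v : Equiv.Perm (Fin (n + 2)), ∀ w : Equiv.Perm (Fin n),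
      v = extendPerm (extendPerm w) → flaggedCharacter k (rotheDiagram v) = schubertPolynomial v
    from H _ w rfl
  intro v
  induction v using transition_induction with
  | one =>
    intro _ _
    rw [schubertPolynomial_one, flaggedCharacter_rotheDiagram_one]
  | step u r s h hu _ =>
    intro w hw
    -- The entry of the extended permutation at r exceeds that at the later position s, so s is not
    -- one of the appended fixed points. Hence u also fixes these points and the induction
    -- hypothesis applies to it.
    have hs : (s : ℕ) < n := by
      by_contra hs
      have h1 := extendPerm_extendPerm_apply_of_le w s (not_lt.mp hs)
      have h2 : u s = extendPerm (extendPerm w) r := by simp [← hw]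
      have h3 : u r = extendPerm (extendPerm w) s := by simp [← hw]
      have h4 := h.val_lt
      rw [h2, h3, h1] at h4
      have h5 := extendPerm_extendPerm_apply_of_le w (extendPerm (extendPerm w) r) (by omega)
      have h6 := (extendPerm (extendPerm w)).injective h5
      rw [h6] at h4
      exact h4.asymm h.lt
    have hrs := h.lt
    obtain ⟨s₀, hs₀⟩ : ∃ s₀ : Fin n, s₀.castSucc.castSucc = s := ⟨⟨s, hs⟩, rfl⟩
    obtain ⟨r₀, hr₀⟩ : ∃ r₀ : Fin n, r₀.castSucc.castSucc = r := ⟨⟨r, by omega⟩, rfl⟩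
    have hu' : u = extendPerm (extendPerm (w * Equiv.swap r₀ s₀)) := by
      rw [extendPerm_mul, extendPerm_mul, extendPerm_swap, extendPerm_swap, hr₀, hs₀, ← hw,
        Equiv.mul_swap_mul_self]
    -- Downward from R = n, the case of the upper bound. As u increases after r, the transition at
    -- (R+1, R+2) has R as a cover position, so equality passes to the exchange of R and R+1.
    have key : ∀ d R, (hR : R + 1 < n + 2) → R + d = n → (s : ℕ) ≤ R →
        flaggedCharacter k (rotheDiagram (u * Equiv.swap ⟨R, by omega⟩ ⟨R + 1, hR⟩)) =
          schubertPolynomial (u * Equiv.swap ⟨R, by omega⟩ ⟨R + 1, hR⟩) := by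
      intro d
      induction d with
      | zero =>
        intro R hR hRn _
        obtain rfl : R = n := hRn
        have := flaggedCharacter_extendPerm_mul_swap (k := k) (w * Equiv.swap r₀ s₀)
          (hu' ▸ hu _ hu')
        rw [← hu'] at this
        exact this
      | succ d ih =>
        intro R hR hRn hsR
        have ht : IsTransition u ⟨R + 1, by omega⟩ ⟨R + 1 + 1, by omega⟩ := by
          refine ⟨by simp, fun a b ha hab => h.inc a b ?_ hab, h.inc _ _ ?_ (by simp),
            fun a ha ha' => ?_⟩
          · simp only [Fin.lt_def] at ha hrs ⊢; omega
          · simp only [Fin.lt_def] at hrs ⊢; omega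
          · simp only [Fin.lt_def] at ha ha'; omega
        refine ht.flaggedCharacter_eq ⟨by simp, h.inc _ _ ?_ (by simp), fun c hc hc' => ?_⟩
          (ih (R + 1) (by omega) (by omega) (by omega))
        · simp only [Fin.lt_def] at hrs ⊢; omega
        · simp only [Fin.lt_def] at hc hc'; omega
    -- In the transition at (s, s+1), r itself is a cover position, which reaches u(r s).
    have ht : IsTransition u s ⟨s + 1, by omega⟩ := by
      refine ⟨by simp [Fin.lt_def], fun a b ha hab => h.inc a b (hrs.trans ha) hab,
        h.inc _ _ hrs (by simp [Fin.lt_def]), fun a ha ha' => ?_⟩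
      simp only [Fin.lt_def] at ha ha'; omega
    exact ht.flaggedCharacter_eq h.isCover (key (n - s) s (by omega) (by omega) le_rfl)

end Main

theorem mainTheorem2 (k : Type*) [Field k] (n : ℕ) (w : Equiv.Perm (Fin n)) :
    flaggedCharacter k (rotheDiagram w) = schubertPolynomial w := by
  have h := flaggedCharacter_extendPerm_extendPerm (k := k) w
  rw [flaggedCharacter_extendPerm, flaggedCharacter_extendPerm, schubertPolynomial_extendPerm,
    schubertPolynomial_extendPerm] at h
  exact rename_injective _ (Fin.castSucc_injective n)
    (rename_injective _ (Fin.castSucc_injective (n + 1)) h)
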